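/- Let $0<q<1$, $n\ge 0$, $\sigma\in S_n$ and $a_1,\dots,a_n\in\mathbb Z_{\ge0}$. Write $|A|=\sum_j a_j$, $A^i=\sum_{j>i}a_j$, $\ell(\sigma)=\#\{j<k:\sigma(j)>\sigma(k)\}$, $(a;p)_k=\prod_{l<k}(1-ap^l)$, $(a_1,\dots,a_r;p)_\infty=\prod_{i=1}^r\prod_{l\ge0}(1-a_ip^l)$, $[m]_p!=\prod_{j=1}^m\frac{p^j-1}{p-1}$, $$e_p(z)=\sum_{k\ge0}\frac{z^k}{(p;p)_k},\qquad E_p(z)=\sum_{k\ge0}\frac{p^{k(k-1)/2}z^k}{(p;p)_k},\qquad b_{q^2}=(1-q^2)(q^2,-q^2,-1;q^2)_\infty,$$ $$h_l(z;p)=(p;p)_l\sum_{k=0}^{\lfloor l/2\rfloor}\frac{(-1)^kp^{k(k-1)}z^{l-2k}}{(p^2;p^2)_k(p;p)_{l-2k}},\qquad \tilde h_l(z;p)=(p;p)_l\sum_{k=0}^{\lfloor l/2\rfloor}\frac{(-1)^kp^{-2kl+k(2k+1)}z^{l-2k}}{(p^2;p^2)_k(p;p)_{l-2k}}.$$ Let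 $\hat V$ be the algebra of formal power series over $\mathbb C$ in $x_1,\dots,x_n$ with $x_ix_j=q\,x_jx_i$ for $i>j$, written in the increasing monomials $x^E=x_1^{e_1}\cdots x_n^{e_n}$, and let $V$ be the algebra of formal power series in $\partial_1,\dots,\partial_n$ with $\partial_i\partial_j=q\,\partial_j\partial_i$ for $i<j$, written in the decreasing monomials $\partial_n^{e_n}\cdots\partial_1^{e_1}$. For $f=\sum_E f_Ex^E\in\hat V$ put $f_{\cdot1}(\underline z)=\sum_E f_E z_1^{e_1}\cdots z_n^{e_n}$, and let $\Pi_0f$ be the part of $f$ that is even in every variable. *Lattice order integral.* Let $\gamma\in\mathbb R_{>0}^n$. For $f\in\hat V$ with $(\Pi_0f)_{\cdot1}$ entire let $$\Bigl(\int_lf\Bigr)(\underline z)=(1-q^2)\sum_{h\in\mathbb Z}\sum_{\varepsilon=\pm1}q^{2h}\Bigl(x_l\,(\Pi_0f)(q^{-2}x_1,\dots,q^{-2}x_{l-1},\varepsilon q^{2h}x_l,x_{l+1},\dots,x_n)\Bigr)_{\cdot1}\Big|_{z_l=\gamma_l}.$$ If this converges absolutely for all values of the other variables and is an entire function of them, $I_lf$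 denotes the unique series without $x_l$ such that $(I_lf)_{\cdot1}=\int_lf$. A series $f$ such that $f_{\cdot1}$ converges near $0$ is lattice order integrable for $(\sigma,\gamma)$ if $I''_{(\sigma,\gamma)}f:=I_{\sigma(n)}\cdots I_{\sigma(1)}f$ is defined; this is then a complex number. $\mathcal R_{(\sigma,\gamma)}$ is the set of $f$ such that $f\,x_1^{e_1}\cdots x_n^{e_n}$ is lattice order integrable for $(\sigma,\gamma)$ for all $E$, and the weak transform $F''(\sigma,\gamma)\colon\mathcal R_{(\sigma,\gamma)}\to V$ is $$F''(\sigma,\gamma)f=\sum_EI''_{(\sigma,\gamma)}\bigl(f\,x_1^{e_1}\cdots x_n^{e_n}\bigr)\prod_{j=1}^n\frac{1}{[e_j]_{q^2}!}\Bigl(\frac{i\,q^{1-j}}{1-q^2}\Bigr)^{e_j}\ \partial_n^{e_n}\cdots\partial_1^{e_1}.$$ Let $\gamma_{\sigma(k)}=q^{(k-1)+A^{\sigma(k)}+\#\{j<k\,:\,\sigma(j)>\sigma(k)\}}$ and $\tilde\gamma_k=q^{A^k}\gamma_k$. All products $\prod_{j=n}^1$ are taken in decreasing order of $j$. Then: 1.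 $E_{q^4}(-q^4\sum_jx_j^2)$ is lattice order integrable for $(\sigma,\tilde\gamma)$ and $I''_{(\sigma,\tilde\gamma)}\bigl(E_{q^4}(-q^4\sum_jx_j^2)\bigr)=b_{q^2}^n\,q^{\binom n2+\ell(\sigma)}$. 2. $N(\underline x,A)=E_{q^4}(-q^4x_n^2)x_n^{a_n}\cdots E_{q^4}(-q^4x_1^2)x_1^{a_1}$ is in $\mathcal R_{(\sigma,\gamma)}$ and $$F''(\sigma,\gamma)(N(\underline x,A))=q^{\sum_j(a_j^2-a_j)}\,i^{|A|}\,b_{q^2}^n\,q^{\binom n2+\ell(\sigma)}\prod_{j=n}^1\tilde h_{a_j}(\partial_j;q^2)\,e_{q^4}(-\partial_j^2).$$ 3. $E_{q^4}(-q^4x_n^2)h_{a_n}(x_n;q^2)\cdots E_{q^4}(-q^4x_1^2)h_{a_1}(x_1;q^2)$ is in $\mathcal R_{(\sigma,\gamma)}$ and its transform under $F''(\sigma,\gamma)$ is $$i^{|A|}\,q^{\sum_j(a_j^2-a_j)}\,I''_{(\sigma,\tilde\gamma)}\Bigl(E_{q^4}\bigl(-q^4\textstyle\sum_jx_j^2\bigr)\Bigr)\prod_{j=n}^1\partial_j^{a_j}\,e_{q^4}(-\partial_j^2).$$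 -/

import Mathlib

noncomputable section

namespace QuantumSpace

open Finset

/-! ### Basic hypergeometric notation -/

/-- The shifted factorial `(a; p)_k = ∏_{l < k} (1 - a p ^ l)`. -/
def qPoch (a p : ℝ) (k : ℕ) : ℝ := ∏ l ∈ range k, (1 - a * p ^ l)

/-- The infinite shifted factorial `(a; p)_∞`. -/
def qPochInf (a p : ℝ) : ℝ := ∏' l : ℕ, (1 - a * p ^ l)

/-- The number `[m]_p = (p ^ m - 1) / (p - 1)`. -/
def qNumber (p : ℝ) (m : ℕ) : ℝ := (p ^ m - 1) / (p - 1)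

/-- The factorial `[m]_p! = [1]_p [2]_p ⋯ [m]_p`. -/
def qFactorial (p : ℝ) (m : ℕ) : ℝ := ∏ j ∈ range m, qNumber p (j + 1)

/-- The coefficients of `e_p(z) = ∑_k z ^ k / (p; p)_k`. -/
def smallExp (p : ℝ) (k : ℕ) : ℂ := ((1 / qPoch p p k : ℝ) : ℂ)

/-- The coefficients of `E_p(z) = ∑_k p ^ (k (k - 1) / 2) z ^ k / (p; p)_k`. -/
def bigExp (p : ℝ) (k : ℕ) : ℂ := ((p ^ k.choose 2 / qPoch p p k : ℝ) : ℂ)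

/-- The constant `b_{q²} = (1 - q²) (q², -q², -1; q²)_∞`. -/
def bConst (q : ℝ) : ℝ :=
  (1 - q ^ 2) * (qPochInf (q ^ 2) (q ^ 2) * qPochInf (-q ^ 2) (q ^ 2) * qPochInf (-1) (q ^ 2))

/-! ### Formal power series in `q`-commuting variables -/

/-- Formal power series `∑_E f E • x^E` in `n` variables, where the `x^E` are monomials written in a
fixed normal order and the multiplication is determined by
`x^E * x^F = q ^ (∑ i j, B i j * E i * F j) • x^(E + F)`. -/
def TwistedSeries (n : ℕ) (_q : ℝ) (_B : Fin n → Fin n → ℕ) : Type := (Fin n →₀ ℕ) → ℂ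

namespace TwistedSeries

variable {n : ℕ} {q : ℝ} {B : Fin n → Fin n → ℕ}

instance : AddCommGroup (TwistedSeries n q B) := inferInstanceAs (AddCommGroup ((Fin n →₀ ℕ) → ℂ))

instance : Module ℂ (TwistedSeries n q B) := inferInstanceAs (Module ℂ ((Fin n →₀ ℕ) → ℂ))

/-- The reordering factor `q ^ (∑ i j, B i j * E i * F j)`. -/
def weight (q : ℝ) (B : Fin n → Fin n → ℕ) (E F : Fin n →₀ ℕ) : ℂ :=
  (q : ℂ) ^ (∑ i, ∑ j, B i j * E i * F j)

/-- The normally ordered monomial `x^E`. -/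
def mono (E : Fin n →₀ ℕ) : TwistedSeries n q B := fun F => if F = E then 1 else 0

/-- The `i`-th variable. -/
def X (i : Fin n) : TwistedSeries n q B := mono (Finsupp.single i 1)

instance : One (TwistedSeries n q B) := ⟨mono 0⟩

instance : Mul (TwistedSeries n q B) :=
  ⟨fun f g => fun E => ∑ p ∈ antidiagonal E, weight q B p.1 p.2 * (f p.1 * g p.2)⟩

theorem mul_apply (f g : TwistedSeries n q B) (E : Fin n →₀ ℕ) :
    (f * g) E = ∑ p ∈ antidiagonal E, weight q B p.1 p.2 * (f p.1 * g p.2) := rfl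

theorem one_apply (E : Fin n →₀ ℕ) : (1 : TwistedSeries n q B) E = if E = 0 then 1 else 0 := rfl

theorem add_apply (f g : TwistedSeries n q B) (E : Fin n →₀ ℕ) : (f + g) E = f E + g E := rfl

theorem zero_apply (E : Fin n →₀ ℕ) : (0 : TwistedSeries n q B) E = 0 := rfl

theorem smul_apply (c : ℂ) (f : TwistedSeries n q B) (E : Fin n →₀ ℕ) : (c • f) E = c * f E := rfl

theorem weight_add_left (E F G : Fin n →₀ ℕ) :
    weight q B (E + F) G = weight q B E G * weight q B F G := by
  simp only [weight, ← pow_add, ← Finset.sum_add_distrib, Finsupp.add_apply]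
  congr 1
  exact Finset.sum_congr rfl fun i _ => Finset.sum_congr rfl fun j _ => by ring

theorem weight_add_right (E F G : Fin n →₀ ℕ) :
    weight q B E (F + G) = weight q B E F * weight q B E G := by
  simp only [weight, ← pow_add, ← Finset.sum_add_distrib, Finsupp.add_apply]
  congr 1
  exact Finset.sum_congr rfl fun i _ => Finset.sum_congr rfl fun j _ => by ring

theorem weight_zero_left (E : Fin n →₀ ℕ) : weight q B 0 E = 1 := by simp [weight]

theorem weight_zero_right (E : Fin n →₀ ℕ) : weight q B E 0 = 1 := by simp [weight]

instance : Ring (TwistedSeries n q B) :=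
  { (inferInstance : AddCommGroup (TwistedSeries n q B)) with
    mul := (· * ·)
    one := 1
    left_distrib := fun f g h => by
      funext E
      simp only [mul_apply, add_apply, mul_add, Finset.sum_add_distrib]
    right_distrib := fun f g h => by
      funext E
      simp only [mul_apply, add_apply, add_mul, mul_add, Finset.sum_add_distrib]
    zero_mul := fun f => by
      funext E
      simp [mul_apply, zero_apply]
    mul_zero := fun f => by
      funext E
      simp [mul_apply, zero_apply]
    one_mul := fun f => by
      funext E
      rw [mul_apply, Finset.sum_eq_single (0, E)]
      · simp [one_apply, weight_zero_left]
      · rintro ⟨a, b⟩ hab hne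
        rw [HasAntidiagonal.mem_antidiagonal] at hab
        have ha : a ≠ 0 := by
          rintro rfl
          exact hne (by simpa using hab)
        simp [one_apply, ha]
      · simp
    mul_one := fun f => by
      funext E
      rw [mul_apply, Finset.sum_eq_single (E, 0)]
      · simp [one_apply, weight_zero_right]
      · rintro ⟨a, b⟩ hab hne
        rw [HasAntidiagonal.mem_antidiagonal] at hab
        have hb : b ≠ 0 := by
          rintro rfl
          exact hne (by simpa using hab)
        simp [one_apply, hb]
      · simp
    mul_assoc := fun f g h => by
      funext E
      simp only [mul_apply, Finset.sum_mul, Finset.mul_sum, Finset.sum_sigma']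
      refine Finset.sum_nbij' (fun ⟨⟨_, j⟩, ⟨k, l⟩⟩ => ⟨(k, l + j), (l, j)⟩)
        (fun ⟨⟨i, _⟩, ⟨k, l⟩⟩ => ⟨(i + k, l), (i, k)⟩) ?_ ?_ ?_ ?_ ?_ <;>
        simp only [mem_sigma, HasAntidiagonal.mem_antidiagonal]
      · rintro ⟨⟨i, j⟩, ⟨k, l⟩⟩ hE
        dsimp only at hE ⊢
        obtain ⟨rfl, rfl⟩ := hE
        exact ⟨(add_assoc _ _ _).symm, trivial⟩
      · rintro ⟨⟨i, j⟩, ⟨k, l⟩⟩ hE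
        dsimp only at hE ⊢
        obtain ⟨rfl, rfl⟩ := hE
        exact ⟨add_assoc _ _ _, trivial⟩
      · rintro ⟨⟨i, j⟩, ⟨k, l⟩⟩ hE
        dsimp only at hE ⊢
        obtain ⟨rfl, rfl⟩ := hE
        rfl
      · rintro ⟨⟨i, j⟩, ⟨k, l⟩⟩ hE
        dsimp only at hE ⊢
        obtain ⟨rfl, rfl⟩ := hE
        rfl
      · rintro ⟨⟨i, j⟩, ⟨k, l⟩⟩ hE
        dsimp only at hE ⊢
        obtain ⟨rfl, rfl⟩ := hE
        simp only [weight_add_left, weight_add_right]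
        ring }

theorem smul_mul_eq (c : ℂ) (f g : TwistedSeries n q B) : c • f * g = c • (f * g) := by
  funext E
  simp only [mul_apply, smul_apply, Finset.mul_sum]
  exact Finset.sum_congr rfl fun p _ => by ring

theorem mul_smul_eq (c : ℂ) (f g : TwistedSeries n q B) : f * c • g = c • (f * g) := by
  funext E
  simp only [mul_apply, smul_apply, Finset.mul_sum]
  exact Finset.sum_congr rfl fun p _ => by ring

instance : Algebra ℂ (TwistedSeries n q B) := Algebra.ofModule smul_mul_eq mul_smul_eq

theorem mono_mul_mono (E F : Fin n →₀ ℕ) :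
    (mono E * mono F : TwistedSeries n q B) = weight q B E F • mono (E + F) := by
  funext G
  rw [mul_apply, smul_apply]
  by_cases h : G = E + F
  · subst h
    rw [Finset.sum_eq_single (E, F)]
    · simp [mono]
    · rintro ⟨a, b⟩ - hne
      simp only [mono]
      by_cases ha : a = E
      · have hb : b ≠ F := by
          rintro rfl
          exact hne (by rw [ha])
        simp [hb]
      · simp [ha]
    · simp
  · rw [Finset.sum_eq_zero]
    · simp [mono, h]
    · rintro ⟨a, b⟩ hab
      rw [HasAntidiagonal.mem_antidiagonal] at hab
      simp only [mono]
      by_cases ha : a = E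
      · have hb : b ≠ F := by
          rintro rfl
          exact h (by rw [← hab, ha])
        simp [hb]
      · simp [ha]

/-- The series `∑_k c k • u ^ k`, for `u` without constant term (then `u ^ k` has no term of total
degree less than `k`, so that each coefficient is a finite sum). -/
def subst (c : ℕ → ℂ) (u : TwistedSeries n q B) : TwistedSeries n q B :=
  fun E => ∑ k ∈ range (E.degree + 1), c k * (u ^ k) E

/-- The product `F (n-1) * ⋯ * F 1 * F 0`, in decreasing order of the index. -/
def decProd (F : Fin n → TwistedSeries n q B) : TwistedSeries n q B :=
  ((List.finRange n).reverse.map F).prod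

/-- The discrete Hermite I polynomial `h_l(u; p)`. -/
def hermiteI (p : ℝ) (l : ℕ) (u : TwistedSeries n q B) : TwistedSeries n q B :=
  ∑ k ∈ range (l / 2 + 1),
    ((qPoch p p l * ((-1) ^ k * p ^ (k * (k - 1)) /
      (qPoch (p ^ 2) (p ^ 2) k * qPoch p p (l - 2 * k))) : ℝ) : ℂ) • u ^ (l - 2 * k)

/-- The discrete Hermite II polynomial `h̃_l(u; p)`. -/
def hermiteII (p : ℝ) (l : ℕ) (u : TwistedSeries n q B) : TwistedSeries n q B :=
  ∑ k ∈ range (l / 2 + 1),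
    ((qPoch p p l * ((-1) ^ k * p ^ (-2 * (k : ℤ) * l + k * (2 * k + 1)) /
      (qPoch (p ^ 2) (p ^ 2) k * qPoch p p (l - 2 * k))) : ℝ) : ℂ) • u ^ (l - 2 * k)

end TwistedSeries

open TwistedSeries

/-- The completed braided covector algebra: formal power series in `x_1, …, x_n` with
`x_i x_j = q x_j x_i` for `i > j`, expanded in the increasing monomials `x_1^{e_1} ⋯ x_n^{e_n}`. -/
abbrev CovExt (q : ℝ) (n : ℕ) : Type := TwistedSeries n q (fun i j => if j < i then 1 else 0)

/-- The completed braided vector algebra: formal power series in `∂_1, …, ∂_n` with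
`∂_i ∂_j = q ∂_j ∂_i` for `i < j`, expanded in the decreasing monomials
`∂_n^{e_n} ⋯ ∂_1^{e_1}`. -/
abbrev VecExt (q : ℝ) (n : ℕ) : Type := TwistedSeries n q (fun i j => if i < j then 1 else 0)

/-- The variable `x_i`. -/
abbrev xv (q : ℝ) {n : ℕ} (i : Fin n) : CovExt q n := TwistedSeries.X i

/-- The variable `∂_i`. -/
abbrev dv (q : ℝ) {n : ℕ} (i : Fin n) : VecExt q n := TwistedSeries.X i

theorem xv_mul_xv (q : ℝ) {n : ℕ} {i j : Fin n} (h : j < i) :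
    xv q i * xv q j = (q : ℂ) • (xv q j * xv q i) := by
  simp only [xv, X, mono_mul_mono, weight, Finsupp.single_apply]
  simp [h, h.not_gt, add_comm]

theorem dv_mul_dv (q : ℝ) {n : ℕ} {i j : Fin n} (h : i < j) :
    dv q i * dv q j = (q : ℂ) • (dv q j * dv q i) := by
  simp only [dv, X, mono_mul_mono, weight, Finsupp.single_apply]
  simp [h, h.not_gt, add_comm]

/-! ### Lattice order integrals -/

section Integral

variable {q : ℝ} {n : ℕ}

/-- The value at `z` of `f ▷ 1`, where `x_1^{e_1} ⋯ x_n^{e_n} ▷ 1 = z_1^{e_1} ⋯ z_n^{e_n}`. -/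
def evalOne (f : CovExt q n) (z : Fin n → ℂ) : ℂ := ∑' E : Fin n →₀ ℕ, f E * ∏ i, z i ^ E i

/-- `f ▷ 1` converges absolutely in a neighbourhood of zero. -/
def IsClassC (f : CovExt q n) : Prop :=
  ∃ r : ℝ, 0 < r ∧ Summable fun E : Fin n →₀ ℕ => ‖f E‖ * r ^ E.degree

/-- `f ▷ 1` is an entire power series. -/
def IsEntire (f : CovExt q n) : Prop :=
  ∀ z : Fin n → ℂ, Summable fun E : Fin n →₀ ℕ => f E * ∏ i, z i ^ E i

/-- `f (a_1 x_1, …, a_n x_n)`. -/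
def rescale (a : Fin n → ℂ) (f : CovExt q n) : CovExt q n := fun E => f E * ∏ i, a i ^ E i

/-- The part of `f` that is even in every variable. -/
def evenPart (f : CovExt q n) : CovExt q n := fun E => if ∀ i, Even (E i) then f E else 0

/-- The series `f (q⁻² x_1, …, q⁻² x_{l-1}, t x_l, x_{l+1}, …, x_n)`. -/
def shiftAt (l : Fin n) (t : ℂ) (f : CovExt q n) : CovExt q n :=
  rescale (fun i => if i < l then (q : ℂ)⁻¹ ^ 2 else if i = l then t else 1) f

/-- The `h`-th term of `∫_{-x_l·∞}^{x_l·∞} f`, which is the sum over all integers `h` of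
`(1 - q²) q^{2h} x_l (f (…, q^{2h} x_l, …) + f (…, -q^{2h} x_l, …))`. -/
def integralTerm (l : Fin n) (f : CovExt q n) (h : ℤ) : CovExt q n :=
  ((1 - (q : ℂ) ^ 2) * (q : ℂ) ^ (2 * h)) •
    (xv q l * (shiftAt l ((q : ℂ) ^ (2 * h)) f + shiftAt l (-(q : ℂ) ^ (2 * h)) f))

/-- `g = I_l f`: the function `∫_l f` of the variables other than `z_l`, that is, the integral with
respect to `x_l` of the even part of `f`, applied to `1` and evaluated at `z_l = γ_l`, converges
absolutely everywhere, it is entire, and `g` is the series without `x_l` with `g ▷ 1 = ∫_l f`. -/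
structure IsPartialIntegral (γ : Fin n → ℝ) (l : Fin n) (f g : CovExt q n) : Prop where
  entire_left : IsEntire (evenPart f)
  entire_right : IsEntire g
  indep : ∀ E : Fin n →₀ ℕ, E l ≠ 0 → g E = 0
  hasSum : ∀ z : Fin n → ℂ,
    HasSum (fun h : ℤ => evalOne (integralTerm l (evenPart f) h) (Function.update z l (γ l : ℂ)))
      (evalOne g z)

/-- The iterated integral of `f`, first over `x_{σ(1)}`, then over `x_{σ(2)}`, and so on, exists on
the lattice generated by `γ` and equals the constant `c`. -/
def HasLOIntegral (σ : Equiv.Perm (Fin n)) (γ : Fin n → ℝ) (f : CovExt q n) (c : ℂ) : Prop :=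
  ∃ g : Fin (n + 1) → CovExt q n, g 0 = f ∧
    (∀ k : Fin n, IsPartialIntegral γ (σ k) (g k.castSucc) (g k.succ)) ∧
    g (Fin.last n) = c • (1 : CovExt q n)

/-- `f` is lattice order integrable for the order `σ` and the lattice generated by `γ`. -/
def LOIntegrable (σ : Equiv.Perm (Fin n)) (γ : Fin n → ℝ) (f : CovExt q n) : Prop :=
  IsClassC f ∧ ∃ c, HasLOIntegral σ γ f c

open Classical in
/-- The lattice order integral `I''_{(σ, γ)} f` (zero if `f` is not integrable). -/
def loIntegral (σ : Equiv.Perm (Fin n)) (γ : Fin n → ℝ) (f : CovExt q n) : ℂ :=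
  if h : ∃ c, HasLOIntegral σ γ f c then h.choose else 0

/-- The class `R_{(σ, γ)}`: `f x_1^{e_1} ⋯ x_n^{e_n}` is lattice order integrable for all `E`. -/
def IsClassR (σ : Equiv.Perm (Fin n)) (γ : Fin n → ℝ) (f : CovExt q n) : Prop :=
  ∀ E : Fin n →₀ ℕ, LOIntegrable σ γ (f * mono E)

/-- The weak braided Fourier transform `F''(σ, γ)`, that is,
`(I'' ⊗ id) (f · exp (x | i (1 - q²)⁻¹ (∂_1, …, q^{1-j} ∂_j, …, q^{1-n} ∂_n)))`, where
`exp (x | ∂) = ∑_E x_1^{e_1} ⋯ x_n^{e_n} ⊗ ∂_n^{e_n} / [e_n]_{q²}! ⋯ ∂_1^{e_1} / [e_1]_{q²}!`.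
The indices of the variables are counted from zero in the code. -/
def weakFourier (σ : Equiv.Perm (Fin n)) (γ : Fin n → ℝ) (f : CovExt q n) : VecExt q n :=
  fun E => loIntegral σ γ (f * mono E) *
    ∏ j : Fin n, (Complex.I / (1 - (q : ℂ) ^ 2) * (q : ℂ)⁻¹ ^ (j : ℕ)) ^ E j /
      (qFactorial (q ^ 2) (E j) : ℂ)

end Integral

/-! ### Lattices and Gaussians -/

/-- `A^i = ∑_{j > i} a_j`. -/
def tailSum {n : ℕ} (a : Fin n → ℕ) (i : Fin n) : ℕ := ∑ j ∈ univ.filter (fun j => i < j), a j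

/-- `#{j < k | σ(j) > σ(k)}`. -/
def invAt {n : ℕ} (σ : Equiv.Perm (Fin n)) (k : Fin n) : ℕ :=
  (univ.filter fun j : Fin n => j < k ∧ σ k < σ j).card

/-- The length of a permutation (its number of inversions). -/
def permLength {n : ℕ} (σ : Equiv.Perm (Fin n)) : ℕ := ∑ k, invAt σ k

/-- The tuple `γ` with `γ_{σ(k)} = q ^ (k - 1 + A^{σ(k)} + #{j < k | σ(j) > σ(k)})`
(here `k` is counted from zero). -/
def latticeBase {n : ℕ} (q : ℝ) (σ : Equiv.Perm (Fin n)) (a : Fin n → ℕ) (i : Fin n) : ℝ :=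
  q ^ ((σ.symm i : ℕ) + tailSum a i + invAt σ (σ.symm i))

/-- The tuple `γ̃` with `γ̃_i = q ^ A^i γ_i`. -/
def latticeShift {n : ℕ} (q : ℝ) (σ : Equiv.Perm (Fin n)) (a : Fin n → ℕ) (i : Fin n) : ℝ :=
  q ^ tailSum a i * latticeBase q σ a i

/-- `E_{q⁴}(-q⁴ u²)`. -/
def bigGauss {n : ℕ} {q : ℝ} (u : CovExt q n) : CovExt q n :=
  subst (bigExp (q ^ 4)) (-((q : ℂ) ^ 4 • u ^ 2))

/-- `e_{q⁴}(-u²)`. -/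
def smallGauss {n : ℕ} {q : ℝ} (u : VecExt q n) : VecExt q n :=
  subst (smallExp (q ^ 4)) (-(u ^ 2))

/-- `E_{q⁴}(-q⁴ ∑_j x_j²)`. -/
def totalGauss (q : ℝ) (n : ℕ) : CovExt q n :=
  subst (bigExp (q ^ 4)) (-((q : ℂ) ^ 4 • ∑ j, xv q j ^ 2))

end QuantumSpace

end

noncomputable section

namespace QuantumSpace

open Finset Filter Topology PowerSeries

/-! ### The `q`-exponential functions -/

/-! Put `Q = q²`. The proof reduces every integral to one-variable moments over the lattice `±Q^t`.

One variable. `E_{Q²}(-Q²y²)` vanishes at `Q^{-t}` for `t > 0` and equals `(Q²;Q²)_∞ / (Q²;Q²)_t` at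
`Q^t` for `t ≥ 0`. Hence its bilateral lattice moments are one-sided sums, namely values of the
series `e_{Q²}`; with Euler's identity `(Q;Q²)_∞ (-Q;Q)_∞ = 1` the moment of `y^{2k}` is `b_Q
(Q;Q²)_k` (`latticeMoment_bigGauss_even`). The three-term recurrences of the discrete Hermite
polynomials then give closed forms for the moments of `h_a` and for the Taylor coefficients of `h̃_a
e_{Q²}(-y²)` (`latticeMoment_hermiteSeriesI`, `coeff_hermiteSeriesII_mul_smallGauss`), and comparing
them yields the one-variable transforms (`transform_monomial`, `transform_hermite`).

Several variables. A decreasing product of one-variable series times `x^F`, put into normal order,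
is a `gaussState`, and this class is stable under integrating out one variable
(`isPartialIntegral_gaussState`). With the other exponents fixed, the commutation relations only
dilate the argument of the `l`-th series by a power of `q`. The parities of the exponents and of `γ`
make the dilated lattice a translate by an integral power of `q²`, and a bilateral lattice sum is
translation invariant up to a Jacobian; the Jacobian is absorbed in the scaling exponents `ρ` of the
other variables. Iterating gives a product of one-variable moments times `q^{binom(n,2)+ℓ(σ)} ∏
q^{(j-1)F_j}` (`hasLOIntegral_gaussState`, `prod_gaussState_integral`), and the last product cancels
against the factors `q^{1-j}` in the kernel of the transform. The total Gaussian is itself a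
decreasing product, since the `x_j²` commute up to `q⁴` (`totalGauss_eq_decProd`). As the integral
is defined by choice, uniqueness of entire expansions is needed as well (`HasLOIntegral.unique`). -/

theorem qPoch_succ (a p : ℝ) (k : ℕ) : qPoch a p (k + 1) = qPoch a p k * (1 - a * p ^ k) :=
  prod_range_succ _ _

@[simp] theorem qPoch_zero (a p : ℝ) : qPoch a p 0 = 1 := rfl

theorem qPoch_self_succ (p : ℝ) (k : ℕ) : qPoch p p (k + 1) = qPoch p p k * (1 - p ^ (k + 1)) := by
  rw [qPoch_succ, pow_succ']

theorem qPoch_pos {a p : ℝ} (ha : a < 1) (hp0 : 0 < p) (hp1 : p < 1) (k : ℕ) :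
    0 < qPoch a p k := by
  refine prod_pos fun l _ => ?_
  have h1 : p ^ l ≤ 1 := pow_le_one₀ hp0.le hp1.le
  have h2 : 0 < p ^ l := pow_pos hp0 l
  rcases le_or_gt a 0 with h | h <;> nlinarith

theorem summable_bigExp {p : ℝ} (hp0 : 0 < p) (hp1 : p < 1) (z : ℝ) :
    Summable fun k : ℕ => p ^ k.choose 2 / qPoch p p k * z ^ k := by
  -- The ratio test needs nonzero terms.
  rcases eq_or_ne z 0 with rfl | hz
  · exact summable_of_ne_finset_zero (s := {0}) fun k hk => by simp_all
  have hpos := fun k => qPoch_pos hp1 hp0 hp1 k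
  refine summable_of_ratio_test_tendsto_lt_one (l := 0) one_pos
    (Eventually.of_forall fun k => by
      have := (hpos k).ne'
      positivity) ?_
  have hp := tendsto_pow_atTop_nhds_zero_of_lt_one hp0.le hp1
  have h : Tendsto (fun k : ℕ => p ^ k * |z| / (1 - p ^ (k + 1))) atTop (𝓝 (0 * |z| / (1 - 0))) :=
    (hp.mul_const _).div (tendsto_const_nhds.sub ((tendsto_add_atTop_iff_nat 1).2 hp)) (by norm_num)
  simp only [zero_mul, zero_div] at h
  refine h.congr fun k => ?_
  have h1 : 0 < 1 - p ^ (k + 1) := sub_pos.2 (pow_lt_one₀ hp0.le hp1 (by simp))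
  have h2 := hpos k
  rw [qPoch_self_succ, Nat.choose_succ_succ' k 1, Nat.choose_one_right]
  simp only [norm_mul, norm_div, norm_pow, Real.norm_eq_abs, abs_of_pos hp0, abs_of_pos h1,
    abs_of_pos h2]
  have : |z| ≠ 0 := abs_ne_zero.2 hz
  rw [pow_succ |z| k]
  field_simp
  rw [← pow_add]

/-- The function `E_p(z)`. -/
def bigExpFun (p z : ℝ) : ℝ := ∑' k : ℕ, p ^ k.choose 2 / qPoch p p k * z ^ k

/-- The function `e_p(z)`. -/
def smallExpFun (p z : ℝ) : ℝ := ∑' k : ℕ, z ^ k / qPoch p p k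

/-- Replacing `z` by `p z` multiplies the `k`-th term by `p^k`. In the difference, `1 - p^k` cancels
the last factor of `(p;p)_k`, and the index shifts by one. -/
theorem bigExpFun_eq {p : ℝ} (hp0 : 0 < p) (hp1 : p < 1) (z : ℝ) :
    bigExpFun p z = (1 + z) * bigExpFun p (p * z) := by
  have hs := summable_bigExp hp0 hp1
  have h : bigExpFun p z - bigExpFun p (p * z) = z * bigExpFun p (p * z) := by
    unfold bigExpFun
    rw [← (hs z).tsum_sub (hs (p * z)), ((hs z).sub (hs (p * z))).tsum_eq_zero_add, ← tsum_mul_left]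
    simp only [Nat.choose_zero_succ, pow_zero, sub_self, zero_add]
    refine tsum_congr fun k => ?_
    have h1 : 1 - p ^ (k + 1) ≠ 0 := (sub_pos.2 (pow_lt_one₀ hp0.le hp1 (by simp))).ne'
    have h2 := (qPoch_pos hp1 hp0 hp1 k).ne'
    rw [qPoch_self_succ, Nat.choose_succ_succ' k 1, Nat.choose_one_right, mul_pow, mul_pow, pow_add]
    field_simp
    ring
  linarith

theorem bigExpFun_zero (p : ℝ) : bigExpFun p 0 = 1 := by
  rw [bigExpFun, tsum_eq_single 0 fun k hk => by simp [hk]]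
  simp

theorem tendsto_bigExpFun {p : ℝ} (hp0 : 0 < p) (hp1 : p < 1) {u : ℕ → ℝ}
    (hu : Tendsto u atTop (𝓝 0)) : Tendsto (fun N => bigExpFun p (u N)) atTop (𝓝 1) := by
  rw [← bigExpFun_zero p]
  refine tendsto_tsum_of_dominated_convergence (summable_bigExp hp0 hp1 1).norm
    (fun k => (hu.pow k).const_mul _) ?_
  filter_upwards [hu.abs.eventually_le_const (u := 1) (by simp)] with N hN k
  simp only [norm_mul, norm_pow, one_pow, mul_one]
  exact mul_le_of_le_one_right (norm_nonneg _) (pow_le_one₀ (norm_nonneg _) hN)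

theorem bigExpFun_mul_pow {p : ℝ} (hp0 : 0 < p) (hp1 : p < 1) (z : ℝ) (N : ℕ) :
    bigExpFun p (-z) = qPoch z p N * bigExpFun p (-(z * p ^ N)) := by
  induction N with
  | zero => simp
  | succ N ih =>
    rw [ih, bigExpFun_eq hp0 hp1, qPoch_succ, pow_succ]
    ring_nf

/-- The factor `1 + z` of the functional equation gives the zero at `-1`, which the equation carries
to every `-p^{-N}`. These zeros make the bilateral lattice sums one-sided. -/
theorem bigExpFun_neg_inv_pow {p : ℝ} (hp0 : 0 < p) (hp1 : p < 1) (N : ℕ) :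
    bigExpFun p (-(p ^ N)⁻¹) = 0 := by
  induction N with
  | zero =>
    rw [bigExpFun_eq hp0 hp1]
    simp
  | succ N ih =>
    rw [bigExpFun_eq hp0 hp1, show p * -(p ^ (N + 1))⁻¹ = -(p ^ N)⁻¹ by
      rw [pow_succ]; field_simp, ih, mul_zero]

theorem summable_smallExp {p z : ℝ} (hp0 : 0 < p) (hp1 : p < 1) (hz0 : 0 < z) (hz1 : z < 1) :
    Summable fun k : ℕ => z ^ k / qPoch p p k := by
  have hpos := fun k => qPoch_pos hp1 hp0 hp1 k
  refine summable_of_ratio_test_tendsto_lt_one (l := z) hz1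
    (Eventually.of_forall fun k => by
      have := (hpos k).ne'
      positivity) ?_
  have hp := tendsto_pow_atTop_nhds_zero_of_lt_one hp0.le hp1
  have h : Tendsto (fun k : ℕ => z / (1 - p ^ (k + 1))) atTop (𝓝 (z / (1 - 0))) :=
    tendsto_const_nhds.div (tendsto_const_nhds.sub ((tendsto_add_atTop_iff_nat 1).2 hp))
      (by norm_num)
  simp only [sub_zero, div_one] at h
  refine h.congr fun k => ?_
  have h1 : 0 < 1 - p ^ (k + 1) := sub_pos.2 (pow_lt_one₀ hp0.le hp1 (by simp))
  have h2 := hpos k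
  rw [qPoch_self_succ]
  simp only [norm_mul, norm_div, norm_pow, Real.norm_eq_abs, abs_of_pos h1,
    abs_of_pos h2, abs_of_pos hz0]
  rw [pow_succ z k]
  field_simp

theorem smallExpFun_mul {p z : ℝ} (hp0 : 0 < p) (hp1 : p < 1) (hz0 : 0 < z) (hz1 : z < 1) :
    smallExpFun p (p * z) = (1 - z) * smallExpFun p z := by
  have hs := summable_smallExp hp0 hp1 hz0 hz1
  have hs' := summable_smallExp hp0 hp1 (z := p * z) (by positivity) (by nlinarith)
  have h : smallExpFun p z - smallExpFun p (p * z) = z * smallExpFun p z := by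
    unfold smallExpFun
    rw [← hs.tsum_sub hs', (hs.sub hs').tsum_eq_zero_add, ← tsum_mul_left]
    simp only [pow_zero, sub_self, zero_add]
    refine tsum_congr fun k => ?_
    have h1 : 1 - p ^ (k + 1) ≠ 0 := (sub_pos.2 (pow_lt_one₀ hp0.le hp1 (by simp))).ne'
    have h2 := (qPoch_pos hp1 hp0 hp1 k).ne'
    rw [qPoch_self_succ, mul_pow]
    field_simp
    ring
  linarith

theorem smallExpFun_mul_pow {p z : ℝ} (hp0 : 0 < p) (hp1 : p < 1) (hz0 : 0 < z) (hz1 : z < 1)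
    (N : ℕ) : smallExpFun p (z * p ^ N) = qPoch z p N * smallExpFun p z := by
  induction N with
  | zero => simp
  | succ N ih =>
    have h1 : p ^ N ≤ 1 := pow_le_one₀ hp0.le hp1.le
    rw [show z * p ^ (N + 1) = p * (z * p ^ N) by ring,
      smallExpFun_mul hp0 hp1 (by positivity) (by nlinarith), ih, qPoch_succ]
    ring

theorem tendsto_smallExpFun {p z : ℝ} (hp0 : 0 < p) (hp1 : p < 1) (hz0 : 0 < z) (hz1 : z < 1) :
    Tendsto (fun N => smallExpFun p (z * p ^ N)) atTop (𝓝 1) := by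
  have h0 : smallExpFun p 0 = 1 := by
    rw [smallExpFun, tsum_eq_single 0 fun k hk => by simp [hk]]
    simp
  have hu : Tendsto (fun N => z * p ^ N) atTop (𝓝 0) := by
    simpa using (tendsto_pow_atTop_nhds_zero_of_lt_one hp0.le hp1).const_mul z
  rw [← h0]
  refine tendsto_tsum_of_dominated_convergence (summable_smallExp hp0 hp1 hz0 hz1)
    (fun k => (hu.pow k).div_const _) (Eventually.of_forall fun N k => ?_)
  have hq := qPoch_pos hp1 hp0 hp1 k
  rw [Real.norm_of_nonneg (by positivity)]
  gcongr
  exact mul_le_of_le_one_right hz0.le (pow_le_one₀ hp0.le hp1.le)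

/-! ### Infinite shifted factorials -/

theorem multipliable_qPoch {p : ℝ} (hp0 : 0 < p) (hp1 : p < 1) (a : ℝ) :
    Multipliable fun l : ℕ => 1 - a * p ^ l := by
  simp_rw [sub_eq_add_neg]
  refine multipliable_one_add_of_summable ?_
  have := ((summable_geometric_of_lt_one hp0.le hp1).mul_left a).norm
  simpa using this

theorem tendsto_qPoch {p : ℝ} (hp0 : 0 < p) (hp1 : p < 1) (a : ℝ) :
    Tendsto (qPoch a p) atTop (𝓝 (qPochInf a p)) :=
  (multipliable_qPoch hp0 hp1 a).hasProd.tendsto_prod_nat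

theorem qPochInf_ne_zero {p a : ℝ} (hp0 : 0 < p) (hp1 : p < 1) (ha : a < 1) :
    qPochInf a p ≠ 0 := by
  unfold qPochInf
  simp_rw [sub_eq_add_neg]
  refine tprod_one_add_ne_zero_of_summable (fun l => ?_) ?_
  · have h1 : p ^ l ≤ 1 := pow_le_one₀ hp0.le hp1.le
    have h2 : 0 < p ^ l := pow_pos hp0 l
    rcases le_or_gt a 0 with h | h <;> nlinarith
  · have := ((summable_geometric_of_lt_one hp0.le hp1).mul_left a).norm
    simpa using this

theorem bigExpFun_neg_self {p : ℝ} (hp0 : 0 < p) (hp1 : p < 1) :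
    bigExpFun p (-p) = qPochInf p p := by
  have hu : Tendsto (fun N => -(p * p ^ N)) atTop (𝓝 0) := by
    simpa using ((tendsto_pow_atTop_nhds_zero_of_lt_one hp0.le hp1).const_mul p).neg
  have h := (tendsto_qPoch hp0 hp1 p).mul (tendsto_bigExpFun hp0 hp1 hu)
  rw [mul_one] at h
  refine tendsto_nhds_unique (tendsto_const_nhds.congr fun N => ?_) h
  exact bigExpFun_mul_pow hp0 hp1 p N

/-- Let `N → ∞` in `e_p(z p^N) = (z;p)_N e_p(z)`. -/
theorem smallExpFun_mul_qPochInf {p z : ℝ} (hp0 : 0 < p) (hp1 : p < 1) (hz0 : 0 < z)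
    (hz1 : z < 1) : qPochInf z p * smallExpFun p z = 1 := by
  refine tendsto_nhds_unique ((tendsto_qPoch hp0 hp1 z).mul_const _)
    ((tendsto_smallExpFun hp0 hp1 hz0 hz1).congr fun N => ?_)
  exact smallExpFun_mul_pow hp0 hp1 hz0 hz1 N

theorem qPochInf_sq {Q : ℝ} (h0 : 0 < Q) (h1 : Q < 1) :
    qPochInf Q Q * qPochInf (-Q) Q = qPochInf (Q ^ 2) (Q ^ 2) := by
  unfold qPochInf
  rw [← (multipliable_qPoch h0 h1 Q).tprod_mul (multipliable_qPoch h0 h1 (-Q))]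
  exact tprod_congr fun l => by ring

theorem qPochInf_neg_one {Q : ℝ} (h0 : 0 < Q) (h1 : Q < 1) :
    qPochInf (-1) Q = 2 * qPochInf (-Q) Q := by
  refine tendsto_nhds_unique ((tendsto_add_atTop_iff_nat 1).2 (tendsto_qPoch h0 h1 (-1)))
    (((tendsto_qPoch h0 h1 (-Q)).const_mul 2).congr fun N => ?_)
  unfold qPoch
  rw [prod_range_succ']
  rw [mul_comm]
  congr 1
  · exact prod_congr rfl fun l _ => by ring
  · norm_num

theorem qPochInf_even_mul_odd {Q : ℝ} (h0 : 0 < Q) (h1 : Q < 1) :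
    qPochInf Q (Q ^ 2) * qPochInf (Q ^ 2) (Q ^ 2) = qPochInf Q Q := by
  have h2 : Q ^ 2 < 1 := pow_lt_one₀ h0.le h1 two_ne_zero
  have e1 : ∀ k, 1 - Q * Q ^ (2 * k) = 1 - Q * (Q ^ 2) ^ k := fun k => by rw [pow_mul]
  have e2 : ∀ k, 1 - Q * Q ^ (2 * k + 1) = 1 - Q ^ 2 * (Q ^ 2) ^ k := fun k => by
    rw [← pow_mul]; ring
  unfold qPochInf
  rw [← tprod_even_mul_odd (f := fun l => 1 - Q * Q ^ l)]
  · simp only [e1, e2]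
  · simpa only [e1] using multipliable_qPoch (by positivity) h2 Q
  · simpa only [e2] using multipliable_qPoch (by positivity) h2 (Q ^ 2)

/-- Compare `(Q;Q)_∞ (-Q;Q)_∞ = (Q²;Q²)_∞` with `(Q;Q²)_∞ (Q²;Q²)_∞ = (Q;Q)_∞` and cancel
`(Q²;Q²)_∞`. -/
theorem qPochInf_euler {Q : ℝ} (h0 : 0 < Q) (h1 : Q < 1) :
    qPochInf Q (Q ^ 2) * qPochInf (-Q) Q = 1 := by
  have h2 : Q ^ 2 < 1 := pow_lt_one₀ h0.le h1 two_ne_zero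
  have hne := qPochInf_ne_zero (p := Q ^ 2) (by positivity) h2 h2
  have ha := qPochInf_sq h0 h1
  have hb := qPochInf_even_mul_odd h0 h1
  rw [← hb] at ha
  refine mul_right_cancel₀ hne ?_
  linear_combination ha

/-! ### Entire power series in one variable and their moments on a lattice -/

/-- The power series `ψ` has infinite radius of convergence. -/
def EntireSeries (ψ : ℝ⟦X⟧) : Prop := ∀ r : ℝ, 0 ≤ r → Summable fun k => ‖coeff k ψ‖ * r ^ k

/-- The value of the power series `ψ` at `y`. -/
def seriesEval (ψ : ℝ⟦X⟧) (y : ℝ) : ℝ := ∑' k, coeff k ψ * y ^ k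

/-- The integral of `ψ` over the lattice generated by `1`, for `ψ` even and vanishing at all `Q⁻ᵗ`,
`t > 0`. -/
def latticeMoment (Q : ℝ) (ψ : ℝ⟦X⟧) : ℝ :=
  2 * (1 - Q) * ∑' t : ℕ, Q ^ t * seriesEval ψ (Q ^ t)

theorem EntireSeries.summable {ψ : ℝ⟦X⟧} (h : EntireSeries ψ) (y : ℝ) :
    Summable fun k => coeff k ψ * y ^ k :=
  Summable.of_norm (by simpa using h |y| (abs_nonneg y))

theorem EntireSeries.add {φ ψ : ℝ⟦X⟧} (h : EntireSeries φ) (h' : EntireSeries ψ) :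
    EntireSeries (φ + ψ) := fun r hr => by
  refine ((h r hr).add (h' r hr)).of_nonneg_of_le (fun k => by positivity) fun k => ?_
  rw [map_add, ← add_mul]
  gcongr
  exact norm_add_le _ _

theorem EntireSeries.smul {ψ : ℝ⟦X⟧} (h : EntireSeries ψ) (c : ℝ) : EntireSeries (c • ψ) :=
  fun r hr => by simpa [mul_assoc] using (h r hr).mul_left |c|

theorem EntireSeries.mul_X {ψ : ℝ⟦X⟧} (h : EntireSeries ψ) : EntireSeries (ψ * X) := fun r hr => by
  rw [← summable_nat_add_iff 1]
  simpa [coeff_succ_mul_X, pow_succ, mul_assoc] using (h r hr).mul_right r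

theorem EntireSeries.mul_X_pow {ψ : ℝ⟦X⟧} (h : EntireSeries ψ) (s : ℕ) :
    EntireSeries (ψ * X ^ s) := by
  induction s with
  | zero => simpa
  | succ s ih => rw [pow_succ, ← mul_assoc]; exact ih.mul_X

theorem seriesEval_add {φ ψ : ℝ⟦X⟧} (h : EntireSeries φ) (h' : EntireSeries ψ) (y : ℝ) :
    seriesEval (φ + ψ) y = seriesEval φ y + seriesEval ψ y := by
  unfold seriesEval
  rw [← (h.summable y).tsum_add (h'.summable y)]
  simp [add_mul]

theorem seriesEval_smul (c : ℝ) (ψ : ℝ⟦X⟧) (y : ℝ) :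
    seriesEval (c • ψ) y = c * seriesEval ψ y := by
  unfold seriesEval
  rw [← tsum_mul_left]
  simp [mul_assoc]

theorem seriesEval_mul_X {ψ : ℝ⟦X⟧} (h : EntireSeries ψ) (y : ℝ) :
    seriesEval (ψ * X) y = seriesEval ψ y * y := by
  unfold seriesEval
  rw [(h.mul_X.summable y).tsum_eq_zero_add, ← tsum_mul_right]
  simp [coeff_succ_mul_X, pow_succ, mul_assoc]

theorem seriesEval_mul_X_pow {ψ : ℝ⟦X⟧} (h : EntireSeries ψ) (s : ℕ) (y : ℝ) :
    seriesEval (ψ * X ^ s) y = seriesEval ψ y * y ^ s := by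
  induction s with
  | zero => simp
  | succ s ih => rw [pow_succ, ← mul_assoc, seriesEval_mul_X (h.mul_X_pow s), ih]; ring

theorem EntireSeries.norm_eval_le {ψ : ℝ⟦X⟧} (h : EntireSeries ψ) {y : ℝ} (hy : |y| ≤ 1) :
    ‖seriesEval ψ y‖ ≤ ∑' k, ‖coeff k ψ‖ := by
  have h1 : Summable fun k => ‖coeff k ψ‖ := by simpa using h 1 zero_le_one
  refine tsum_of_norm_bounded h1.hasSum fun k => ?_
  rw [norm_mul, norm_pow]
  exact mul_le_of_le_one_right (norm_nonneg _) (pow_le_one₀ (norm_nonneg _) hy)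

theorem EntireSeries.summable_moment {ψ : ℝ⟦X⟧} (h : EntireSeries ψ) {Q : ℝ} (h0 : 0 < Q)
    (h1 : Q < 1) : Summable fun t : ℕ => Q ^ t * seriesEval ψ (Q ^ t) := by
  refine Summable.of_norm_bounded ((summable_geometric_of_lt_one h0.le h1).mul_right
    (∑' k, ‖coeff k ψ‖)) fun t => ?_
  have : |Q ^ t| ≤ 1 := by
    rw [abs_of_pos (by positivity)]
    exact pow_le_one₀ h0.le h1.le
  rw [norm_mul, Real.norm_of_nonneg (by positivity)]
  gcongr
  exact h.norm_eval_le this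

theorem latticeMoment_add {φ ψ : ℝ⟦X⟧} (h : EntireSeries φ) (h' : EntireSeries ψ) {Q : ℝ}
    (h0 : 0 < Q) (h1 : Q < 1) :
    latticeMoment Q (φ + ψ) = latticeMoment Q φ + latticeMoment Q ψ := by
  unfold latticeMoment
  rw [← mul_add, ← (h.summable_moment h0 h1).tsum_add (h'.summable_moment h0 h1)]
  simp only [seriesEval_add h h', mul_add]

theorem latticeMoment_smul (c : ℝ) (ψ : ℝ⟦X⟧) (Q : ℝ) :
    latticeMoment Q (c • ψ) = c * latticeMoment Q ψ := by
  unfold latticeMoment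
  simp only [seriesEval_smul, mul_left_comm _ c, tsum_mul_left]

/-! ### Gaussians -/

/-- The coefficients of `E_{Q²}(-Q² y²)`. -/
def bigGaussSeries (Q : ℝ) : ℝ⟦X⟧ := PowerSeries.mk fun e =>
  if Even e then (Q ^ 2) ^ (e / 2).choose 2 / qPoch (Q ^ 2) (Q ^ 2) (e / 2) * (-Q ^ 2) ^ (e / 2)
  else 0

/-- The coefficients of `e_{Q²}(-y²)`. -/
def smallGaussSeries (Q : ℝ) : ℝ⟦X⟧ := PowerSeries.mk fun e =>
  if Even e then (-1) ^ (e / 2) / qPoch (Q ^ 2) (Q ^ 2) (e / 2) else 0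

section Gauss

variable {Q : ℝ} (h0 : 0 < Q) (h1 : Q < 1)

theorem support_subset_range_double {f : ℕ → ℝ} (hf : ∀ e, ¬ Even e → f e = 0) :
    Function.support f ⊆ Set.range (fun k : ℕ => 2 * k) := fun e he => by
  have : Even e := by
    by_contra h
    exact he (hf e h)
  obtain ⟨k, rfl⟩ := this
  exact ⟨k, by simp only; omega⟩

theorem double_injective : Function.Injective (fun k : ℕ => 2 * k) := fun a b h => by
  simp only at h
  omega

include h0 h1 in
theorem entireSeries_bigGauss : EntireSeries (bigGaussSeries Q) := fun r hr => by
  have h2 : Q ^ 2 < 1 := pow_lt_one₀ h0.le h1 two_ne_zero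
  refine (double_injective.summable_iff fun e he => ?_).1 ?_
  · by_contra h
    exact he (support_subset_range_double (f := fun e => ‖coeff e (bigGaussSeries Q)‖ * r ^ e)
      (fun e he => by simp [bigGaussSeries, he]) h)
  · refine (summable_bigExp (by positivity) h2 (Q ^ 2 * r ^ 2)).norm.congr fun k => ?_
    simp [bigGaussSeries, mul_pow, pow_mul, abs_of_nonneg hr, abs_div, mul_assoc]

theorem seriesEval_bigGauss (y : ℝ) :
    seriesEval (bigGaussSeries Q) y = bigExpFun (Q ^ 2) (-(Q ^ 2 * y ^ 2)) := by
  unfold seriesEval bigExpFun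
  rw [← double_injective.tsum_eq (support_subset_range_double fun e he => by
    simp [bigGaussSeries, he])]
  refine tsum_congr fun k => ?_
  have h : -(Q ^ 2 * y ^ 2) = -Q ^ 2 * y ^ 2 := by ring
  simp only [bigGaussSeries, coeff_mk, even_two.mul_right, if_true,
    Nat.mul_div_cancel_left k two_pos]
  rw [h, mul_pow, pow_mul, mul_assoc]

include h0 h1 in
theorem seriesEval_bigGauss_pow (t : ℕ) : seriesEval (bigGaussSeries Q) (Q ^ t) =
    qPochInf (Q ^ 2) (Q ^ 2) / qPoch (Q ^ 2) (Q ^ 2) t := by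
  have h2 : Q ^ 2 < 1 := pow_lt_one₀ h0.le h1 two_ne_zero
  have h3 := qPoch_pos h2 (by positivity) h2 t
  rw [seriesEval_bigGauss, eq_div_iff h3.ne', ← bigExpFun_neg_self (by positivity) h2,
    bigExpFun_mul_pow (by positivity) h2 (Q ^ 2) t, mul_comm, ← pow_mul, ← pow_mul, mul_comm t]

include h0 h1 in
theorem seriesEval_bigGauss_inv_pow (t : ℕ) :
    seriesEval (bigGaussSeries Q) (Q ^ (t + 1))⁻¹ = 0 := by
  have h2 : Q ^ 2 < 1 := pow_lt_one₀ h0.le h1 two_ne_zero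
  rw [seriesEval_bigGauss, ← bigExpFun_neg_inv_pow (p := Q ^ 2) (by positivity) h2 t]
  congr 2
  field_simp
  ring

include h0 h1 in
-- The value of the Gaussian at `Q^t` supplies the denominators `(Q²;Q²)_t` of the series `e_{Q²}`.
-- In its argument, `Q^s` comes from `y^s` and one further `Q` from the lattice weight.
theorem latticeMoment_bigGauss (s : ℕ) : latticeMoment Q (bigGaussSeries Q * X ^ s) =
    2 * (1 - Q) * qPochInf (Q ^ 2) (Q ^ 2) * smallExpFun (Q ^ 2) (Q ^ (s + 1)) := by
  unfold latticeMoment smallExpFun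
  rw [mul_assoc _ (qPochInf _ _), ← tsum_mul_left (a := qPochInf _ _)]
  congr 1
  refine tsum_congr fun t => ?_
  rw [seriesEval_mul_X_pow (entireSeries_bigGauss h0 h1), seriesEval_bigGauss_pow h0 h1]
  rw [← pow_mul, ← pow_mul, mul_comm t, mul_comm (s + 1), mul_comm s, mul_add, pow_add]
  ring

include h0 h1 in
-- The relation `e_p(z p^k) = (z;p)_k e_p(z)` splits off `(Q;Q²)_k`. What remains is `e_{Q²}(Q) =
-- 1/(Q;Q²)_∞ = (-Q;Q)_∞`, and the factor 2 from the two signs goes into `(-1;Q)_∞ = 2 (-Q;Q)_∞`.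
theorem latticeMoment_bigGauss_even (k : ℕ) :
    latticeMoment Q (bigGaussSeries Q * X ^ (2 * k)) =
      (1 - Q) * (qPochInf Q Q * qPochInf (-Q) Q * qPochInf (-1) Q) * qPoch Q (Q ^ 2) k := by
  have h2 : Q ^ 2 < 1 := pow_lt_one₀ h0.le h1 two_ne_zero
  have e1 := smallExpFun_mul_qPochInf (p := Q ^ 2) (by positivity) h2 h0 h1
  have e2 := qPochInf_euler h0 h1
  have e3 : smallExpFun (Q ^ 2) Q = qPochInf (-Q) Q :=
    mul_left_cancel₀ (left_ne_zero_of_mul_eq_one e1) (e1.trans e2.symm)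
  rw [latticeMoment_bigGauss h0 h1, pow_succ' Q (2 * k), pow_mul Q 2 k,
    smallExpFun_mul_pow (by positivity) h2 h0 h1, e3, qPochInf_neg_one h0 h1, qPochInf_sq h0 h1]
  ring

end Gauss

/-! ### Discrete Hermite polynomials -/

/-- The polynomial `∑_k (-1)^k (p;p)_l w l k / ((p²;p²)_k (p;p)_{l-2k}) y^{l-2k}`. -/
def hermiteSeries (p : ℝ) (w : ℕ → ℕ → ℝ) (l : ℕ) : ℝ⟦X⟧ :=
  ∑ k ∈ range (l / 2 + 1),
    (qPoch p p l * ((-1) ^ k * w l k / (qPoch (p ^ 2) (p ^ 2) k * qPoch p p (l - 2 * k)))) •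
      X ^ (l - 2 * k)

theorem hermiteSeries_zero {p : ℝ} {w : ℕ → ℕ → ℝ} (hw : w 0 0 = 1) : hermiteSeries p w 0 = 1 := by
  simp [hermiteSeries, hw]

theorem hermiteSeries_one {p : ℝ} {w : ℕ → ℕ → ℝ} (hp0 : 0 < p) (hp1 : p < 1) (hw : w 1 0 = 1) :
    hermiteSeries p w 1 = X := by
  simp [hermiteSeries, hw, (qPoch_pos hp1 hp0 hp1 1).ne']

/-- The two Hermite families differ only in the weight `w`. Hypothesis `hw` is the comparison of the
coefficients of `y^m` with the common shifted factorials removed. -/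
theorem hermiteSeries_recursion {p : ℝ} (hp0 : 0 < p) (hp1 : p < 1) {w : ℕ → ℕ → ℝ} {d : ℕ → ℝ}
    (hw0 : ∀ l, w l 0 = 1)
    (hw : ∀ k m, (1 - p ^ (m + 2 * k + 2)) * w (m + 2 * k + 2) (k + 1) =
      (1 - p ^ m) * w (m + 2 * k + 1) (k + 1) +
        d (m + 2 * k) * (1 - p ^ (2 * k + 2)) * w (m + 2 * k) k) (l : ℕ) :
    hermiteSeries p w (l + 2) = hermiteSeries p w (l + 1) * X +
      (-(d l * (1 - p ^ (l + 1)))) • hermiteSeries p w l := by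
  have hp2 : p ^ 2 < 1 := pow_lt_one₀ hp0.le hp1 two_ne_zero
  have hpos := fun k => (qPoch_pos hp1 hp0 hp1 k).ne'
  have hpos2 := fun k => (qPoch_pos hp2 (by positivity) hp2 k).ne'
  -- Extending the coefficients by zero lets the three sums share an index range; beyond `2k = l`
  -- the truncated `l - 2k` would produce spurious constant terms.
  set η : ℕ → ℕ → ℝ := fun l k => if 2 * k ≤ l then
    qPoch p p l * ((-1) ^ k * w l k / (qPoch (p ^ 2) (p ^ 2) k * qPoch p p (l - 2 * k))) else 0
    with hη
  have key : ∀ l N, l / 2 < N → hermiteSeries p w l = ∑ k ∈ range N, η l k • X ^ (l - 2 * k) := by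
    intro l N hN
    unfold hermiteSeries
    rw [← sum_subset (range_subset_range.2 (show l / 2 + 1 ≤ N by omega))]
    · refine sum_congr rfl fun k hk => ?_
      have : 2 * k ≤ l := by have := mem_range.1 hk; omega
      simp [hη, this]
    · intro k _ hk
      have : ¬ 2 * k ≤ l := by
        rw [mem_range] at hk
        omega
      simp [hη, this]
  rw [key (l + 2) (l / 2 + 1 + 1) (by omega), key (l + 1) (l / 2 + 1 + 1) (by omega),
    key l (l / 2 + 1) (by omega), sum_mul, smul_sum, sum_range_succ' _ (l / 2 + 1),
    sum_range_succ' _ (l / 2 + 1), add_right_comm, ← sum_add_distrib]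
  congr 1
  · refine sum_congr rfl fun k hk => ?_
    have hk' : 2 * k ≤ l := by have := mem_range.1 hk; omega
    obtain ⟨m, rfl⟩ := Nat.exists_eq_add_of_le' hk'
    have hq1 := qPoch_self_succ p (m + 2 * k + 1)
    have hq2 := qPoch_self_succ p (m + 2 * k)
    have hq3 := qPoch_self_succ (p ^ 2) k
    have hwk := hw k m
    have hη2 : η (m + 2 * k + 2) (k + 1) = η (m + 2 * k + 1) (k + 1) -
        d (m + 2 * k) * (1 - p ^ (m + 2 * k + 1)) * η (m + 2 * k) k := by
      have hk2 := hpos2 k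
      have hk3 : 1 - p ^ (2 * k + 2) ≠ 0 :=
        (sub_pos.2 (pow_lt_one₀ hp0.le hp1 (by simp))).ne'
      rw [← pow_mul, show 2 * (k + 1) = 2 * k + 2 by ring] at hq3
      have e0 : η (m + 2 * k) k = qPoch p p (m + 2 * k) *
          ((-1) ^ k * w (m + 2 * k) k / (qPoch (p ^ 2) (p ^ 2) k * qPoch p p m)) := by
        simp [hη]
      have e2 : η (m + 2 * k + 2) (k + 1) = qPoch p p (m + 2 * k + 2) * ((-1) ^ (k + 1) *
          w (m + 2 * k + 2) (k + 1) / (qPoch (p ^ 2) (p ^ 2) (k + 1) * qPoch p p m)) := by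
        simp only [hη]
        rw [if_pos (by omega), show m + 2 * k + 2 - 2 * (k + 1) = m by omega]
      have e1 : η (m + 2 * k + 1) (k + 1) = qPoch p p (m + 2 * k + 1) * ((-1) ^ (k + 1) *
          ((1 - p ^ m) * w (m + 2 * k + 1) (k + 1)) /
            (qPoch (p ^ 2) (p ^ 2) (k + 1) * qPoch p p m)) := by
        simp only [hη]
        -- For `m = 0` the index `k + 1` is out of range in degree `2k + 1`, in agreement with the
        -- factor `1 - p^m = 0`.
        rcases m with _ | m
        · rw [if_neg (by omega)]
          simp
        · rw [if_pos (by omega), show m + 1 + 2 * k + 1 - 2 * (k + 1) = m by omega,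
            qPoch_self_succ p m]
          have hm : 1 - p ^ (m + 1) ≠ 0 := (sub_pos.2 (pow_lt_one₀ hp0.le hp1 (by simp))).ne'
          have := hpos m
          have := hpos2 (k + 1)
          field_simp
      rw [e0, e1, e2, hq1, hq2, hq3]
      have := hpos m
      field_simp
      rw [pow_succ]
      linear_combination (-(-1) ^ k * qPoch p p (m + 2 * k) * (1 - p ^ (m + 2 * k + 1))) * hwk
    rw [hη2, sub_eq_add_neg, add_smul, smul_smul, neg_mul,
      show m + 2 * k + 2 - 2 * (k + 1) = m + 2 * k - 2 * k by omega]
    congr 1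
    rcases m with _ | m
    · simp only [hη]
      rw [if_neg (by omega), zero_smul, zero_smul, zero_mul]
    · rw [smul_mul_assoc, ← pow_succ]
      congr 2
      omega
  · simp [hη, hw0, hpos, pow_succ]

/-- The discrete Hermite I polynomial as a power series. -/
abbrev hermiteSeriesI (p : ℝ) : ℕ → ℝ⟦X⟧ := hermiteSeries p fun _ k => p ^ (k * (k - 1))

/-- The discrete Hermite II polynomial as a power series. -/
abbrev hermiteSeriesII (p : ℝ) : ℕ → ℝ⟦X⟧ :=
  hermiteSeries p fun l k => p ^ (-2 * (k : ℤ) * l + k * (2 * k + 1))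

theorem hermiteSeriesI_recursion {p : ℝ} (hp0 : 0 < p) (hp1 : p < 1) (l : ℕ) :
    hermiteSeriesI p (l + 2) = hermiteSeriesI p (l + 1) * X +
      (-(p ^ l * (1 - p ^ (l + 1)))) • hermiteSeriesI p l := by
  refine hermiteSeries_recursion hp0 hp1 (by simp) (fun k m => ?_) l
  rcases k with _ | k
  · simp; ring
  · simp only [Nat.add_sub_cancel]
    ring

theorem hermiteSeriesII_recursion {p : ℝ} (hp0 : 0 < p) (hp1 : p < 1) (l : ℕ) :
    hermiteSeriesII p (l + 2) = hermiteSeriesII p (l + 1) * X +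
      (-(p ^ (-2 * (l : ℤ) - 1) * (1 - p ^ (l + 1)))) • hermiteSeriesII p l := by
  refine hermiteSeries_recursion hp0 hp1 (d := fun l => p ^ (-2 * (l : ℤ) - 1)) (by simp)
    (fun k m => ?_) l
  have hp : p ≠ 0 := hp0.ne'
  -- After a common power of `p` is extracted, the identity to check is `1 - p^(m+2k+2) = (1 - p^m)
  -- p^(2k+2) + (1 - p^(2k+2))`.
  have e1 : -2 * ((k + 1 : ℕ) : ℤ) * (m + 2 * k + 2 : ℕ) + (k + 1 : ℕ) * (2 * (k + 1 : ℕ) + 1) =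
    (-2 * k * m - 2 * k * k - 2 * m - 3 * k - 1 : ℤ) := by push_cast; ring
  have e2 : -2 * ((k + 1 : ℕ) : ℤ) * (m + 2 * k + 1 : ℕ) + (k + 1 : ℕ) * (2 * (k + 1 : ℕ) + 1) =
    (-2 * k * m - 2 * k * k - 2 * m - 3 * k - 1 : ℤ) + (2 * k + 2 : ℕ) := by push_cast; ring
  have e3 : p ^ (-2 * (k : ℤ) * (m + 2 * k : ℕ) + k * (2 * k + 1)) *
    p ^ (-2 * ((m + 2 * k : ℕ) : ℤ) - 1) =
    p ^ (-2 * k * m - 2 * k * k - 2 * m - 3 * k - 1 : ℤ) := by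
    rw [← zpow_add₀ hp]
    congr 1
    push_cast
    ring
  rw [e1, e2, zpow_add₀ hp, zpow_natCast]
  linear_combination (-(1 - p ^ (2 * k + 2))) * e3

/-! ### Series integrable over the lattice generated by `1` -/

/-- The entire series `ψ` vanishes at all `Q⁻ᵗ`, `t > 0`. -/
structure LatticeSeries (Q : ℝ) (ψ : ℝ⟦X⟧) : Prop where
  entire : EntireSeries ψ
  eval_inv_pow : ∀ t : ℕ, seriesEval ψ (Q ^ (t + 1))⁻¹ = 0

/-- Only the coefficients of index congruent to `b` modulo two of `ψ` may differ from zero. -/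
def HasParity (ψ : ℝ⟦X⟧) (b : ℕ) : Prop := ∀ e, ¬ Even (e + b) → coeff e ψ = 0

namespace LatticeSeries

variable {Q : ℝ} {φ ψ : ℝ⟦X⟧}

theorem zero : LatticeSeries Q 0 := ⟨fun r _ => by simp [summable_zero], by simp [seriesEval]⟩

theorem add (h : LatticeSeries Q φ) (h' : LatticeSeries Q ψ) : LatticeSeries Q (φ + ψ) :=
  ⟨h.entire.add h'.entire, fun t => by
    rw [seriesEval_add h.entire h'.entire, h.eval_inv_pow, h'.eval_inv_pow, add_zero]⟩

theorem smul (h : LatticeSeries Q ψ) (c : ℝ) : LatticeSeries Q (c • ψ) :=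
  ⟨h.entire.smul c, fun t => by rw [seriesEval_smul, h.eval_inv_pow, mul_zero]⟩

theorem mul_X_pow (h : LatticeSeries Q ψ) (s : ℕ) : LatticeSeries Q (ψ * X ^ s) :=
  ⟨h.entire.mul_X_pow s, fun t => by
    rw [seriesEval_mul_X_pow h.entire, h.eval_inv_pow, zero_mul]⟩

theorem bigGauss (h0 : 0 < Q) (h1 : Q < 1) : LatticeSeries Q (bigGaussSeries Q) :=
  ⟨entireSeries_bigGauss h0 h1, seriesEval_bigGauss_inv_pow h0 h1⟩

theorem mul_hermiteSeries (h : LatticeSeries Q ψ) (p : ℝ) (w : ℕ → ℕ → ℝ) (l : ℕ) :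
    LatticeSeries Q (ψ * hermiteSeries p w l) := by
  rw [hermiteSeries, mul_sum]
  refine sum_induction _ (LatticeSeries Q) (fun _ _ => add) zero fun k _ => ?_
  rw [mul_smul_comm]
  exact (h.mul_X_pow _).smul _

end LatticeSeries

namespace HasParity

variable {φ ψ : ℝ⟦X⟧} {b c : ℕ}

theorem mul (h : HasParity φ b) (h' : HasParity ψ c) : HasParity (φ * ψ) (b + c) := by
  intro e he
  rw [coeff_mul]
  refine sum_eq_zero fun x hx => ?_
  rw [HasAntidiagonal.mem_antidiagonal] at hx
  by_cases h1 : Even (x.1 + b)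
  · rw [h' x.2 fun h2 => he (by rw [← hx, add_add_add_comm]; exact h1.add h2), mul_zero]
  · rw [h x.1 h1, zero_mul]

theorem X_pow (s : ℕ) : HasParity (X ^ s) s := fun e he => by
  rw [coeff_X_pow, if_neg]
  rintro rfl
  exact he ⟨e, rfl⟩

theorem bigGauss (Q : ℝ) : HasParity (bigGaussSeries Q) 0 := fun e he => by
  simp_all [bigGaussSeries]

theorem smallGauss (Q : ℝ) : HasParity (smallGaussSeries Q) 0 := fun e he => by
  simp_all [smallGaussSeries]

theorem hermite (p : ℝ) (w : ℕ → ℕ → ℝ) (l : ℕ) : HasParity (hermiteSeries p w l) l := by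
  intro e he
  rw [hermiteSeries, map_sum]
  refine sum_eq_zero fun k hk => ?_
  have hk := mem_range.1 hk
  rw [coeff_smul, coeff_X_pow, if_neg, smul_zero]
  rintro rfl
  exact he (by rw [Nat.even_iff]; omega)

end HasParity

theorem hermiteSeriesI_zero (p : ℝ) : hermiteSeriesI p 0 = 1 := hermiteSeries_zero (by simp)

theorem hermiteSeriesII_zero (p : ℝ) : hermiteSeriesII p 0 = 1 := hermiteSeries_zero (by simp)

theorem hermiteSeriesI_one {p : ℝ} (hp0 : 0 < p) (hp1 : p < 1) : hermiteSeriesI p 1 = X :=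
  hermiteSeries_one hp0 hp1 (by simp)

theorem hermiteSeriesII_one {p : ℝ} (hp0 : 0 < p) (hp1 : p < 1) : hermiteSeriesII p 1 = X :=
  hermiteSeries_one hp0 hp1 (by simp)

/-! ### Moments of Hermite polynomials and Taylor coefficients of their transforms -/

theorem qPoch_double {Q : ℝ} (k : ℕ) :
    qPoch Q Q (2 * k) = qPoch Q (Q ^ 2) k * qPoch (Q ^ 2) (Q ^ 2) k := by
  induction k with
  | zero => simp
  | succ k ih =>
    rw [show 2 * (k + 1) = 2 * k + 1 + 1 by ring, qPoch_self_succ, qPoch_self_succ, ih, qPoch_succ,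
      qPoch_succ]
    ring

/-- The integral over the lattice generated by `1` of the Gaussian. -/
def gaussMoment (Q : ℝ) : ℝ := (1 - Q) * (qPochInf Q Q * qPochInf (-Q) Q * qPochInf (-1) Q)

section

variable {Q : ℝ} (h0 : 0 < Q) (h1 : Q < 1)

include h0 h1 in
theorem latticeMoment_monomial {a F N : ℕ} (hN : a + F = 2 * N) :
    latticeMoment Q (bigGaussSeries Q * X ^ a * X ^ F) = gaussMoment Q * qPoch Q (Q ^ 2) N := by
  rw [mul_assoc, ← pow_add, hN, latticeMoment_bigGauss_even h0 h1, gaussMoment]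

include h0 h1 in
theorem latticeMoment_hermiteSeriesI_step (a F : ℕ) :
    latticeMoment Q (bigGaussSeries Q * hermiteSeriesI Q (a + 2) * X ^ F) =
      latticeMoment Q (bigGaussSeries Q * hermiteSeriesI Q (a + 1) * X ^ (F + 1)) -
        Q ^ a * (1 - Q ^ (a + 1)) *
          latticeMoment Q (bigGaussSeries Q * hermiteSeriesI Q a * X ^ F) := by
  have hE := fun l s => (((LatticeSeries.bigGauss h0 h1).mul_hermiteSeries Q
    (fun _ k => Q ^ (k * (k - 1))) l).mul_X_pow s).entire
  rw [hermiteSeriesI_recursion h0 h1, mul_add, add_mul, mul_smul_comm, smul_mul_assoc,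
    ← mul_assoc, mul_assoc _ X, ← pow_succ', latticeMoment_add (hE _ _) ((hE _ _).smul _) h0 h1,
    latticeMoment_smul]
  ring

include h0 h1 in
-- Induction along the recurrence, where multiplication by `y` raises `F`. The zero for `F < a` is
-- orthogonality to lower powers.
theorem latticeMoment_hermiteSeriesI (a : ℕ) : ∀ F, Even (a + F) →
    latticeMoment Q (bigGaussSeries Q * hermiteSeriesI Q a * X ^ F) = gaussMoment Q *
      if a ≤ F then Q ^ a.choose 2 * qPoch Q Q F / qPoch (Q ^ 2) (Q ^ 2) ((F - a) / 2) else 0 := by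
  have h2 : Q ^ 2 < 1 := pow_lt_one₀ h0.le h1 two_ne_zero
  have hpos := fun k => (qPoch_pos h1 h0 h1 k).ne'
  have hpos2 := fun k => (qPoch_pos h2 (by positivity) h2 k).ne'
  induction a using Nat.twoStepInduction with
  | zero =>
    rintro F ⟨N, hN⟩
    have hN' : 0 + F = 2 * N := by omega
    have := latticeMoment_monomial h0 h1 hN'
    rw [hermiteSeriesI_zero, ← pow_zero X, this]
    obtain rfl : F = 2 * N := by omega
    have := hpos2 N
    simp only [zero_le, if_true, Nat.choose_zero_succ, Nat.sub_zero,
      Nat.mul_div_cancel_left N two_pos, qPoch_double]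
    field_simp
  | one =>
    rintro F ⟨N, hN⟩
    have hN' : 1 + F = 2 * N := by omega
    have := latticeMoment_monomial h0 h1 hN'
    rw [hermiteSeriesI_one h0 h1]
    rw [pow_one] at this
    rw [this]
    obtain ⟨r, rfl⟩ : ∃ r, N = r + 1 := ⟨N - 1, by omega⟩
    obtain rfl : F = 2 * r + 1 := by omega
    have := hpos2 r
    rw [if_pos (by omega), Nat.add_sub_cancel, Nat.mul_div_cancel_left r two_pos, qPoch_self_succ,
      qPoch_double, qPoch_succ, show Nat.choose 1 2 = 0 from rfl]
    field_simp
    ring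
  | more a ih0 ih1 =>
    intro F hF
    rw [latticeMoment_hermiteSeriesI_step h0 h1, ih1 (F + 1) (by rw [Nat.even_iff] at *; omega),
      ih0 F (by rw [Nat.even_iff] at *; omega)]
    have hc1 : (a + 1).choose 2 = a + a.choose 2 := by
      rw [Nat.choose_succ_succ' a 1, Nat.choose_one_right]
    have hc2 : (a + 2).choose 2 = a + 1 + (a + a.choose 2) := by
      rw [Nat.choose_succ_succ' (a + 1) 1, Nat.choose_one_right, hc1]
    rcases lt_trichotomy F a with h | rfl | h
    · rw [if_neg (by omega), if_neg (by omega), if_neg (by omega)]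
      ring
    -- For `F = a` the two terms of the recurrence cancel; orthogonality originates here.
    · rw [if_pos (by omega), if_pos (by omega), if_neg (by omega), hc1, qPoch_self_succ]
      simp only [Nat.sub_self, Nat.zero_div, qPoch_zero, pow_add]
      ring
    · obtain ⟨r, rfl⟩ : ∃ r, F = a + 2 + 2 * r :=
        ⟨(F - a - 2) / 2, by rw [Nat.even_iff] at hF; omega⟩
      rw [if_pos (by omega), if_pos (by omega), if_pos (by omega), hc1, hc2, qPoch_self_succ,
        show (a + 2 + 2 * r + 1 - (a + 1)) / 2 = r + 1 by omega,
        show (a + 2 + 2 * r - a) / 2 = r + 1 by omega,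
        show (a + 2 + 2 * r - (a + 2)) / 2 = r by omega, qPoch_self_succ (Q ^ 2)]
      have e1 := hpos2 r
      have e2 : 1 - (Q ^ 2) ^ (r + 1) ≠ 0 :=
        (sub_pos.2 (pow_lt_one₀ (by positivity) h2 (by simp))).ne'
      field_simp
      ring

include h0 h1 in
-- The right side contains the moment `(Q;Q²)_N` of `y^{a+F}`, so the Taylor coefficients of `h̃_a
-- e` are, up to sign and normalization, the moments of the Gaussian times `y^a`. The power
-- `Q^{binom(a,2)}` clears the negative powers of `Q` and becomes the `q^{a²-a}` of the theorem.
theorem coeff_hermiteSeriesII_mul_smallGauss (a : ℕ) : ∀ F N, a + F = 2 * N →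
    Q ^ a.choose 2 * coeff F (hermiteSeriesII Q a * smallGaussSeries Q) =
      (-1) ^ (N + a) * qPoch Q (Q ^ 2) N / qPoch Q Q F := by
  have h2 : Q ^ 2 < 1 := pow_lt_one₀ h0.le h1 two_ne_zero
  have hpos := fun k => (qPoch_pos h1 h0 h1 k).ne'
  have hpos2 := fun k => (qPoch_pos h2 (by positivity) h2 k).ne'
  have hpos3 := fun k => (qPoch_pos h1 (by positivity) h2 k).ne'
  induction a using Nat.twoStepInduction with
  | zero =>
    intro F N hN
    obtain rfl : F = 2 * N := by omega
    have := hpos2 N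
    have := hpos3 N
    rw [hermiteSeriesII_zero, one_mul, qPoch_double]
    simp only [smallGaussSeries, coeff_mk, even_two.mul_right, if_true,
      Nat.mul_div_cancel_left N two_pos, Nat.choose_zero_succ, pow_zero, one_mul, add_zero]
    field_simp
  | one =>
    intro F N hN
    obtain ⟨r, rfl⟩ : ∃ r, N = r + 1 := ⟨N - 1, by omega⟩
    obtain rfl : F = 2 * r + 1 := by omega
    have := hpos2 r
    have := hpos3 r
    have hr : 1 - Q ^ (2 * r + 1) ≠ 0 := (sub_pos.2 (pow_lt_one₀ h0.le h1 (by simp))).ne'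
    rw [hermiteSeriesII_one h0 h1, coeff_succ_X_mul, qPoch_self_succ, qPoch_double,
      qPoch_succ, ← pow_mul, ← pow_succ', show Nat.choose 1 2 = 0 from rfl]
    simp only [smallGaussSeries, coeff_mk, even_two.mul_right, if_true,
      Nat.mul_div_cancel_left r two_pos, pow_zero, one_mul]
    field_simp
    ring
  | more a ih0 ih1 =>
    intro F N hN
    obtain ⟨N, rfl⟩ : ∃ M, N = M + 1 := ⟨N - 1, by omega⟩
    have hc1 : (a + 1).choose 2 = a + a.choose 2 := by
      rw [Nat.choose_succ_succ' a 1, Nat.choose_one_right]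
    have hc2 : (a + 2).choose 2 = a + 1 + (a + a.choose 2) := by
      rw [Nat.choose_succ_succ' (a + 1) 1, Nat.choose_one_right, hc1]
    have i0 := ih0 F N (by omega)
    have hrec : Q ^ (a + 2).choose 2 * coeff F (hermiteSeriesII Q (a + 2) * smallGaussSeries Q) =
        Q ^ (a + 1) * (Q ^ (a + 1).choose 2 *
          coeff F (hermiteSeriesII Q (a + 1) * smallGaussSeries Q * X)) -
        (1 - Q ^ (a + 1)) * (Q ^ a.choose 2 *
          coeff F (hermiteSeriesII Q a * smallGaussSeries Q)) := by
      -- `binom(a+2,2) - binom(a,2) = 2a + 1` is exactly the negative exponent in the recurrence.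
      have hQ : Q ^ (-2 * (a : ℤ) - 1) * Q ^ (a + 1 + a) = 1 := by
        rw [← zpow_natCast, ← zpow_add₀ h0.ne']
        push_cast
        ring_nf
        simp
      rw [hermiteSeriesII_recursion h0 h1, add_mul, smul_mul_assoc, map_add, coeff_smul, hc1, hc2,
        mul_right_comm _ X]
      simp only [smul_eq_mul, pow_add] at hQ ⊢
      linear_combination (-(1 - Q ^ a * Q ^ 1) * Q ^ a.choose 2 *
        coeff F (hermiteSeriesII Q a * smallGaussSeries Q)) * hQ
    -- The factor `1 - Q^F` also covers `F = 0`, where multiplication by `X` kills the coefficient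
    -- and the induction hypothesis does not apply.
    have key : Q ^ (a + 1).choose 2 *
          coeff F (hermiteSeriesII Q (a + 1) * smallGaussSeries Q * X) =
        (1 - Q ^ F) * ((-1) ^ (N + a + 1) * qPoch Q (Q ^ 2) N / qPoch Q Q F) := by
      rcases F with _ | F
      · simp
      · rw [coeff_succ_mul_X, ih1 F N (by omega), qPoch_self_succ]
        have := hpos F
        have hr : 1 - Q ^ (F + 1) ≠ 0 := (sub_pos.2 (pow_lt_one₀ h0.le h1 (by simp))).ne'
        field_simp
        ring
    have hQ : Q * Q ^ (2 * N) = Q ^ (a + 1) * Q ^ F := by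
      rw [← pow_succ', ← pow_add]
      congr 1
      omega
    rw [hrec, key, i0, qPoch_succ, ← pow_mul, hQ]
    have := hpos F
    field_simp
    ring

end

end QuantumSpace

namespace QuantumSpace

open Finset PowerSeries

namespace TwistedSeries

variable {n : ℕ} {q : ℝ} {B : Fin n → Fin n → ℕ}

/-! ### Coefficients of products with monomials -/

theorem ext {f g : TwistedSeries n q B} (h : ∀ E, f E = g E) : f = g := funext h

theorem finset_sum_apply {ι : Type*} (s : Finset ι) (f : ι → TwistedSeries n q B)
    (E : Fin n →₀ ℕ) : (∑ i ∈ s, f i) E = ∑ i ∈ s, f i E :=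
  map_sum (⟨⟨fun f => f E, rfl⟩, fun _ _ => rfl⟩ : TwistedSeries n q B →+ ℂ) f s

theorem mono_apply (A E : Fin n →₀ ℕ) :
    (mono A : TwistedSeries n q B) E = if E = A then 1 else 0 := rfl

theorem mono_mul_apply (A : Fin n →₀ ℕ) (f : TwistedSeries n q B) (E : Fin n →₀ ℕ) :
    (mono A * f : TwistedSeries n q B) E = if A ≤ E then weight q B A (E - A) * f (E - A) else 0 := by
  rw [mul_apply]
  split_ifs with h
  · rw [sum_eq_single (A, E - A)]
    · simp [mono]
    · rintro ⟨a, b⟩ hab hne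
      rw [HasAntidiagonal.mem_antidiagonal] at hab
      have : a ≠ A := by
        rintro rfl
        exact hne (by rw [← hab, add_tsub_cancel_left])
      simp [mono, this]
    · intro h'
      rw [HasAntidiagonal.mem_antidiagonal] at h'
      exact absurd (add_tsub_cancel_of_le h) h'
  · refine sum_eq_zero ?_
    rintro ⟨a, b⟩ hab
    rw [HasAntidiagonal.mem_antidiagonal] at hab
    have : a ≠ A := by
      rintro rfl
      exact h (by rw [← hab]; exact le_self_add)
    simp [mono, this]

theorem mul_mono_apply (A : Fin n →₀ ℕ) (f : TwistedSeries n q B) (E : Fin n →₀ ℕ) :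
    (f * mono A : TwistedSeries n q B) E = if A ≤ E then weight q B (E - A) A * f (E - A) else 0 := by
  rw [mul_apply]
  split_ifs with h
  · rw [sum_eq_single (E - A, A)]
    · simp [mono]
    · rintro ⟨a, b⟩ hab hne
      rw [HasAntidiagonal.mem_antidiagonal] at hab
      have : b ≠ A := by
        rintro rfl
        exact hne (by rw [← hab, add_tsub_cancel_right])
      simp [mono, this]
    · intro h'
      rw [HasAntidiagonal.mem_antidiagonal] at h'
      exact absurd (tsub_add_cancel_of_le h) h'
  · refine sum_eq_zero ?_
    rintro ⟨a, b⟩ hab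
    rw [HasAntidiagonal.mem_antidiagonal] at hab
    have : b ≠ A := by
      rintro rfl
      exact h (by rw [← hab]; exact le_add_self)
    simp [mono, this]

/-! ### Series in one of the variables -/

/-- The series in the `j`-th variable with the coefficients of `φ`. -/
def ofSeries (j : Fin n) (φ : ℝ⟦X⟧) : TwistedSeries n q B :=
  fun E => if E = Finsupp.single j (E j) then ((coeff (E j) φ : ℝ) : ℂ) else 0

theorem ofSeries_single (j : Fin n) (φ : ℝ⟦X⟧) (m : ℕ) :
    (ofSeries j φ : TwistedSeries n q B) (Finsupp.single j m) = ((coeff m φ : ℝ) : ℂ) := by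
  simp [ofSeries]

theorem ofSeries_of_ne {j : Fin n} (φ : ℝ⟦X⟧) {E : Fin n →₀ ℕ}
    (h : ∀ m, E ≠ Finsupp.single j m) : (ofSeries j φ : TwistedSeries n q B) E = 0 :=
  if_neg (h _)

theorem eq_ofSeries {j : Fin n} {φ : ℝ⟦X⟧} {f : TwistedSeries n q B}
    (h : ∀ m, f (Finsupp.single j m) = ((coeff m φ : ℝ) : ℂ))
    (h' : ∀ E, (∀ m, E ≠ Finsupp.single j m) → f E = 0) : f = ofSeries j φ := by
  refine ext fun E => ?_
  by_cases hE : ∀ m, E ≠ Finsupp.single j m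
  · rw [h' E hE, ofSeries_of_ne φ hE]
  · push Not at hE
    obtain ⟨m, rfl⟩ := hE
    rw [h, ofSeries_single]

theorem ofSeries_X_pow_eq_mono (j : Fin n) (k : ℕ) :
    (ofSeries j (PowerSeries.X ^ k) : TwistedSeries n q B) = mono (Finsupp.single j k) := by
  refine (eq_ofSeries (fun m => ?_) fun E hE => if_neg (hE k)).symm
  rw [coeff_X_pow]
  by_cases h : m = k
  · simp [h]
  · have : Finsupp.single j m ≠ Finsupp.single j k := fun h' => h (Finsupp.single_injective j h')
    rw [if_neg this, if_neg h, Complex.ofReal_zero]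

theorem ofSeries_sum {ι : Type*} (j : Fin n) (s : Finset ι) (φ : ι → ℝ⟦X⟧) :
    (ofSeries j (∑ i ∈ s, φ i) : TwistedSeries n q B) = ∑ i ∈ s, ofSeries j (φ i) := by
  refine (eq_ofSeries (fun m => ?_) fun E hE => ?_).symm
  · simp [finset_sum_apply, ofSeries_single]
  · rw [finset_sum_apply]
    exact sum_eq_zero fun i _ => ofSeries_of_ne _ hE

theorem ofSeries_smul (j : Fin n) (c : ℝ) (φ : ℝ⟦X⟧) :
    (ofSeries j (c • φ) : TwistedSeries n q B) = (c : ℂ) • ofSeries j φ := by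
  refine (eq_ofSeries (fun m => ?_) fun E hE => ?_).symm
  · simp [smul_apply, ofSeries_single]
  · rw [smul_apply, ofSeries_of_ne _ hE, mul_zero]

theorem weight_single_single {j : Fin n} (hB : B j j = 0) (a b : ℕ) :
    weight q B (Finsupp.single j a) (Finsupp.single j b) = 1 := by
  unfold weight
  rw [sum_eq_single j, sum_eq_single j]
  · simp [hB]
  · intro i _ hi
    simp [Finsupp.single_eq_of_ne hi]
  · simp
  · intro i _ hi
    simp [Finsupp.single_eq_of_ne hi]
  · simp

theorem ofSeries_mul {j : Fin n} (hB : B j j = 0) (φ ψ : ℝ⟦X⟧) :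
    (ofSeries j (φ * ψ) : TwistedSeries n q B) = ofSeries j φ * ofSeries j ψ := by
  refine (eq_ofSeries (fun m => ?_) fun E hE => ?_).symm
  · rw [mul_apply, Finsupp.antidiagonal_single, sum_map, coeff_mul]
    push_cast
    refine sum_congr rfl fun x _ => ?_
    simp [ofSeries_single, weight_single_single hB]
  · rw [mul_apply]
    refine sum_eq_zero ?_
    rintro ⟨a, b⟩ hab
    rw [HasAntidiagonal.mem_antidiagonal] at hab
    by_cases ha : ∀ m, a ≠ Finsupp.single j m
    · rw [ofSeries_of_ne _ ha, zero_mul, mul_zero]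
    by_cases hb : ∀ m, b ≠ Finsupp.single j m
    · rw [ofSeries_of_ne _ hb, mul_zero, mul_zero]
    push Not at ha hb
    obtain ⟨a', ha⟩ := ha
    obtain ⟨b', hb⟩ := hb
    exact absurd (by rw [← hab, Finsupp.single_add, ← ha, ← hb]) (hE (a' + b'))

theorem X_pow_eq_mono {j : Fin n} (hB : B j j = 0) (k : ℕ) :
    (X j ^ k : TwistedSeries n q B) = mono (Finsupp.single j k) := by
  induction k with
  | zero => simp; rfl
  | succ k ih =>
    rw [pow_succ, ih, X, mono_mul_mono, weight_single_single hB, one_smul, ← Finsupp.single_add]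

theorem X_pow_eq_ofSeries {j : Fin n} (hB : B j j = 0) (k : ℕ) :
    (X j ^ k : TwistedSeries n q B) = ofSeries j (PowerSeries.X ^ k) := by
  rw [X_pow_eq_mono hB, ofSeries_X_pow_eq_mono]

theorem hermiteI_X {j : Fin n} (hB : B j j = 0) (p : ℝ) (l : ℕ) :
    (hermiteI p l (X j) : TwistedSeries n q B) = ofSeries j (hermiteSeriesI p l) := by
  simp only [hermiteSeriesI, hermiteSeries, ofSeries_sum, ofSeries_smul, hermiteI,
    X_pow_eq_ofSeries hB]

theorem hermiteII_X {j : Fin n} (hB : B j j = 0) (p : ℝ) (l : ℕ) :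
    (hermiteII p l (X j) : TwistedSeries n q B) = ofSeries j (hermiteSeriesII p l) := by
  simp only [hermiteSeriesII, hermiteSeries, ofSeries_sum, ofSeries_smul, hermiteII,
    X_pow_eq_ofSeries hB]

theorem subst_apply (c : ℕ → ℂ) (u : TwistedSeries n q B) (E : Fin n →₀ ℕ) :
    TwistedSeries.subst c u E = ∑ k ∈ range (E.degree + 1), c k * (u ^ k) E := rfl

theorem subst_smul_X_sq {j : Fin n} (hB : B j j = 0) {c : ℕ → ℂ} {d : ℂ} {φ : ℝ⟦X⟧}
    (h : ∀ k, ((coeff (2 * k) φ : ℝ) : ℂ) = c k * d ^ k) (h' : ∀ e, ¬ Even e → coeff e φ = 0) :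
    TwistedSeries.subst c (d • X j ^ 2 : TwistedSeries n q B) = ofSeries j φ := by
  have hpow : ∀ k, (d • X j ^ 2 : TwistedSeries n q B) ^ k =
      d ^ k • mono (Finsupp.single j (2 * k)) := fun k => by
    rw [smul_pow, ← pow_mul, X_pow_eq_mono hB]
  refine eq_ofSeries (fun m => ?_) fun E hE => ?_ <;> rw [subst_apply] <;>
    simp only [hpow, smul_apply]
  · by_cases hm : Even m
    · obtain ⟨k, hk⟩ := hm
      obtain rfl : m = 2 * k := by omega
      rw [sum_eq_single k]
      · simp [mono, h]
      · intro k' _ hk'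
        have : Finsupp.single j (2 * k) ≠ Finsupp.single j (2 * k') := fun h' =>
          hk' (by have := Finsupp.single_injective j h'; omega)
        rw [mono_apply, if_neg this, mul_zero, mul_zero]
      · intro hk'
        rw [mem_range, Finsupp.degree_single] at hk'
        omega
    · rw [h' m hm, sum_eq_zero, Complex.ofReal_zero]
      intro k _
      have : Finsupp.single j m ≠ Finsupp.single j (2 * k) := fun h' =>
        hm (by rw [Finsupp.single_injective j h']; exact even_two_mul k)
      rw [mono_apply, if_neg this, mul_zero, mul_zero]
  · refine sum_eq_zero fun k _ => ?_
    rw [mono_apply, if_neg (hE _), mul_zero, mul_zero]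

/-! ### Products in decreasing order -/

/-- Since `f` does not involve the `j`-th variable, a single decomposition of `E` contributes. -/
theorem ofSeries_mul_apply {j : Fin n} (φ : ℝ⟦X⟧) {f : TwistedSeries n q B}
    (hf : ∀ E, f E ≠ 0 → E j = 0) (E : Fin n →₀ ℕ) :
    (ofSeries j φ * f : TwistedSeries n q B) E = weight q B (Finsupp.single j (E j)) (E.erase j) *
      (((coeff (E j) φ : ℝ) : ℂ) * f (E.erase j)) := by
  rw [mul_apply, sum_eq_single (Finsupp.single j (E j), E.erase j)]
  · rw [ofSeries_single]
  · rintro ⟨a, b⟩ hab hne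
    rw [HasAntidiagonal.mem_antidiagonal] at hab
    by_cases hb : f b = 0
    · simp [hb]
    by_cases ha : ∀ m, a ≠ Finsupp.single j m
    · rw [ofSeries_of_ne _ ha, zero_mul, mul_zero]
    push Not at ha
    obtain ⟨m, rfl⟩ := ha
    have hbj := hf b hb
    refine absurd ?_ hne
    have hm : E j = m := by rw [← hab]; simp [hbj]
    rw [hm, Prod.mk.injEq]
    refine ⟨rfl, ?_⟩
    dsimp only at hab
    rw [← hab, Finsupp.erase_add, Finsupp.erase_single, zero_add,
      Finsupp.erase_of_notMem_support (by simpa using hbj)]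
  · intro h
    rw [HasAntidiagonal.mem_antidiagonal] at h
    exact absurd (Finsupp.single_add_erase j E) h

/-- The exponent of `q` that arises when the monomials of a product in decreasing order are put
into normal order. -/
def orderExponent (B : Fin n → Fin n → ℕ) (E : Fin n →₀ ℕ) : ℕ :=
  ∑ i, ∑ j, if j < i then B i j * E i * E j else 0

/-- Putting the series in the largest variable `j` in front adds exactly the pairs `(j, k)` with `k
< j`. -/
theorem weight_mul_orderExponent {j : Fin n} {E : Fin n →₀ ℕ} (hE : ∀ i, E i ≠ 0 → i ≤ j) :
    weight q B (Finsupp.single j (E j)) (E.erase j) * (q : ℂ) ^ orderExponent B (E.erase j) =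
      (q : ℂ) ^ orderExponent B E := by
  have hW : (∑ i, ∑ k, B i k * Finsupp.single j (E j) i * E.erase j k) =
      ∑ k, B j k * E j * E.erase j k := by
    rw [sum_eq_single j]
    · simp
    · intro i _ hi
      simp [Finsupp.single_eq_of_ne hi]
    · simp
  have hO : orderExponent B E =
      (∑ k, B j k * E j * E.erase j k) + orderExponent B (E.erase j) := by
    have hsplit : ∀ i, (∑ k, if k < i then B i k * E i * E k else 0) =
        (if i = j then ∑ k, B j k * E j * E.erase j k else 0) +
          ∑ k, if k < i then B i k * E.erase j i * E.erase j k else 0 := by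
      intro i
      by_cases hi : i = j
      · subst hi
        simp only [Finsupp.erase_same, mul_zero, zero_mul, ite_self, sum_const_zero, add_zero,
          if_true]
        refine sum_congr rfl fun k _ => ?_
        by_cases hk : k = i
        · simp [hk]
        rw [Finsupp.erase_ne hk]
        by_cases hk' : E k = 0
        · simp [hk']
        · rw [if_pos (lt_of_le_of_ne (hE k hk') hk)]
      · rw [if_neg hi, zero_add]
        refine sum_congr rfl fun k _ => ?_
        rw [Finsupp.erase_ne hi]
        by_cases hi' : E i = 0
        · simp [hi']
        split_ifs with h
        · rw [Finsupp.erase_ne (h.trans_le (hE i hi')).ne]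
        · rfl
    unfold orderExponent
    rw [sum_congr rfl fun i _ => hsplit i, sum_add_distrib, sum_ite_eq' univ j]
    simp
  rw [weight, hW, ← pow_add, hO]

open Classical in
theorem list_prod_ofSeries_apply (φ : Fin n → ℝ⟦X⟧) {L : List (Fin n)}
    (hL : L.Pairwise (· > ·)) (E : Fin n →₀ ℕ) :
    ((L.map fun j => ofSeries j (φ j)).prod : TwistedSeries n q B) E =
      if ∀ i, i ∉ L → E i = 0 then
        (q : ℂ) ^ orderExponent B E * (L.map fun j => ((coeff (E j) (φ j) : ℝ) : ℂ)).prod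
      else 0 := by
  induction L generalizing E with
  | nil =>
    rw [List.map_nil, List.prod_nil, one_apply]
    by_cases hE : E = 0
    · simp [hE, orderExponent]
    · have : ¬ ∀ i, E i = 0 := fun h => hE (Finsupp.ext h)
      simp [hE, this]
  | cons j L ih =>
    rw [List.pairwise_cons] at hL
    have hj : j ∉ L := fun h => lt_irrefl j (hL.1 j h)
    rw [List.map_cons, List.prod_cons, ofSeries_mul_apply, ih hL.2]
    · by_cases hE : ∀ i, i ∉ j :: L → E i = 0
      · have hE' : ∀ i, i ∉ L → E.erase j i = 0 := fun i hi => by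
          by_cases hij : i = j
          · simp [hij]
          · rw [Finsupp.erase_ne hij, hE i (by simp [hi, hij])]
        have hE2 : ∀ i, E i ≠ 0 → i ≤ j := fun i hi => by
          by_contra h
          refine hi (hE i ?_)
          rw [List.mem_cons, not_or]
          exact ⟨fun h' => h h'.le, fun h' => h (hL.1 i h').le⟩
        rw [if_pos hE, if_pos hE', ← weight_mul_orderExponent hE2, List.map_cons, List.prod_cons]
        have : (L.map fun k => ((coeff (E.erase j k) (φ k) : ℝ) : ℂ)) =
            L.map fun k => ((coeff (E k) (φ k) : ℝ) : ℂ) :=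
          List.map_congr_left fun k hk => by
            rw [Finsupp.erase_ne (hL.1 k hk).ne]
        rw [this]
        ring
      · rw [if_neg hE, if_neg, mul_zero, mul_zero]
        intro h
        refine hE fun i hi => ?_
        rw [List.mem_cons, not_or] at hi
        rw [← h i hi.2, Finsupp.erase_ne hi.1]
    · intro F hF
      rw [ih hL.2] at hF
      by_contra h
      exact hF (if_neg fun h' => h (h' j hj))

theorem decProd_ofSeries_apply (φ : Fin n → ℝ⟦X⟧) (E : Fin n →₀ ℕ) :
    (decProd (fun j => ofSeries j (φ j)) : TwistedSeries n q B) E =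
      (q : ℂ) ^ orderExponent B E * ∏ j, ((coeff (E j) (φ j) : ℝ) : ℂ) := by
  have h : ((List.finRange n).reverse).Pairwise (· > ·) := by
    rw [List.pairwise_reverse]
    exact List.pairwise_lt_finRange n
  rw [decProd, list_prod_ofSeries_apply φ h, if_pos (by simp), List.map_reverse,
    List.prod_reverse, ← List.ofFn_eq_map, List.prod_ofFn]

end TwistedSeries

open TwistedSeries

/-- For the covectors, decreasing order is opposite to normal order, and every pair contributes `e_i
e_j`. For the vectors it is normal order, and there is no factor (`orderExponent_vec`). -/
theorem orderExponent_cov {n : ℕ} (q : ℝ) (E : Fin n →₀ ℕ) :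
    (q : ℂ) ^ orderExponent (fun i j : Fin n => if j < i then 1 else 0) E =
      weight q (fun i j => if j < i then 1 else 0) E E := by
  unfold orderExponent weight
  congr 1
  refine sum_congr rfl fun i _ => sum_congr rfl fun j _ => ?_
  split_ifs with h <;> simp [h]

theorem orderExponent_vec {n : ℕ} (E : Fin n →₀ ℕ) :
    orderExponent (fun i j : Fin n => if i < j then 1 else 0) E = 0 := by
  refine sum_eq_zero fun i _ => sum_eq_zero fun j _ => ?_
  by_cases h : j < i
  · simp [h.not_gt]
  · simp [h]

theorem bigGauss_xv {n : ℕ} (q : ℝ) (j : Fin n) :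
    bigGauss (xv q j) = ofSeries j (bigGaussSeries (q ^ 2)) := by
  have h : -((q : ℂ) ^ 4 • xv q j ^ 2) = (-(q : ℂ) ^ 4) • xv q j ^ 2 := (neg_smul _ _).symm
  rw [bigGauss, h]
  refine subst_smul_X_sq (by simp) (fun k => ?_) fun e he => by simp [bigGaussSeries, he]
  simp [bigGaussSeries, bigExp, ← pow_mul]

theorem smallGauss_dv {n : ℕ} (q : ℝ) (j : Fin n) :
    smallGauss (dv q j) = ofSeries j (smallGaussSeries (q ^ 2)) := by
  have h : -(dv q j ^ 2) = (-1 : ℂ) • dv q j ^ 2 := (neg_one_smul _ _).symm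
  rw [smallGauss, h]
  refine subst_smul_X_sq (by simp) (fun k => ?_) fun e he => by simp [smallGaussSeries, he]
  simp [smallGaussSeries, smallExp, ← pow_mul, div_eq_inv_mul]

/-! ### The Gaussian in all variables -/

theorem choose_two_add (a b : ℕ) : (a + b).choose 2 = a.choose 2 + b.choose 2 + a * b := by
  induction b with
  | zero => simp
  | succ b ih =>
    rw [← add_assoc, Nat.choose_succ_succ' (a + b) 1, Nat.choose_succ_succ' b 1, ih,
      Nat.choose_one_right, Nat.choose_one_right]
    ring

/-- This is why `E_p` of the sum factors: the exponent `binom(∑K,2)` consists of the exponents of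
the separate factors and the reordering factor. -/
theorem choose_two_sum {ι : Type*} [LinearOrder ι] (s : Finset ι) (K : ι → ℕ) :
    (∑ i ∈ s, K i).choose 2 =
      ∑ i ∈ s, (K i).choose 2 + ∑ i ∈ s, ∑ j ∈ s, if j < i then K i * K j else 0 := by
  induction s using Finset.induction_on_max with
  | empty => simp
  | insert a s ha ih =>
    have has : a ∉ s := fun h => lt_irrefl a (ha a h)
    have h1 : ∀ i ∈ s, (∑ j ∈ insert a s, if j < i then K i * K j else 0) =
        ∑ j ∈ s, if j < i then K i * K j else 0 := fun i hi => by
      rw [sum_insert has, if_neg (ha i hi).not_gt, zero_add]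
    have h2 : (∑ j ∈ insert a s, if j < a then K a * K j else 0) = K a * ∑ j ∈ s, K j := by
      rw [sum_insert has, if_neg (lt_irrefl a), zero_add, mul_sum]
      exact sum_congr rfl fun j hj => if_pos (ha j hj)
    rw [sum_insert has, sum_insert has, sum_insert has, choose_two_add, ih, h2, sum_congr rfl h1]
    ring

variable {n : ℕ} {q : ℝ}

theorem weight_cov_single (j : Fin n) (m : ℕ) (F : Fin n →₀ ℕ) :
    weight q (fun i j : Fin n => if j < i then 1 else 0) (Finsupp.single j m) F =
      (q : ℂ) ^ (m * ∑ i with i < j, F i) := by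
  unfold weight
  rw [sum_eq_single j, mul_sum, sum_filter]
  · congr 1
    refine sum_congr rfl fun i _ => ?_
    split_ifs with h <;> simp [h]
  · intro i _ hi
    simp [Finsupp.single_eq_of_ne hi]
  · simp

theorem single_le_iff_le_apply {j : Fin n} {m : ℕ} {E : Fin n →₀ ℕ} :
    Finsupp.single j m ≤ E ↔ m ≤ E j := by
  classical
  rw [Finsupp.le_def]
  refine ⟨fun h => by simpa using h j, fun h i => ?_⟩
  by_cases hi : i = j
  · simpa [hi] using h
  · simp [Finsupp.single_eq_of_ne hi]

/-- The `q⁴`-multinomial theorem. With `p = q⁴` and `E_i = 2K_i`, a factor `x_j²` split off on the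
left passes the variables before it and contributes `p^{∑_{i<j} K_i}`. The recursion closes because
`∑_j (1 - p^{K_j}) ∏_{i<j} p^{K_i}` telescopes to `1 - p^{k+1}`. -/
theorem sum_sq_pow_apply (hq0 : 0 < q) (hq1 : q < 1) (k : ℕ) (E : Fin n →₀ ℕ) :
    ((∑ j, xv q j ^ 2) ^ k : CovExt q n) E =
      if (∀ i, Even (E i)) ∧ E.degree = 2 * k then
        ((qPoch (q ^ 4) (q ^ 4) k / ∏ i, qPoch (q ^ 4) (q ^ 4) (E i / 2) : ℝ) : ℂ) else 0 := by
  have hp1 : q ^ 4 < 1 := pow_lt_one₀ hq0.le hq1 (by norm_num)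
  have hpos := fun k => (qPoch_pos hp1 (by positivity) hp1 k).ne'
  induction k generalizing E with
  | zero =>
    rw [pow_zero, one_apply]
    by_cases hE : E = 0
    · simp [hE]
    · simp [hE, Finsupp.degree_eq_zero_iff]
  | succ k ih =>
    have hX : ∀ j : Fin n, (xv q j ^ 2 : CovExt q n) = mono (Finsupp.single j 2) :=
      fun j => X_pow_eq_mono (by simp) 2
    have hmul : ∀ j : Fin n, (xv q j ^ 2 * (∑ j, xv q j ^ 2) ^ k : CovExt q n) E =
        (if 2 ≤ E j then
          weight q (fun i j : Fin n => if j < i then 1 else 0) (Finsupp.single j 2)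
              (E - Finsupp.single j 2) *
            (if (∀ i, Even ((E - Finsupp.single j 2 : Fin n →₀ ℕ) i)) ∧
                (E - Finsupp.single j 2).degree = 2 * k then
              ((qPoch (q ^ 4) (q ^ 4) k /
                ∏ i, qPoch (q ^ 4) (q ^ 4) ((E - Finsupp.single j 2 : Fin n →₀ ℕ) i / 2) : ℝ) : ℂ) else 0)
          else 0) := fun j => by
      rw [hX j, mono_mul_apply]
      simp only [single_le_iff_le_apply, ih]
    rw [pow_succ', sum_mul, finset_sum_apply]
    simp only [hmul]
    have hdeg : ∀ j, 2 ≤ E j → (E - Finsupp.single j 2).degree + 2 = E.degree := fun j hj => by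
      have := congrArg Finsupp.degree (tsub_add_cancel_of_le (single_le_iff_le_apply.2 hj))
      rwa [map_add, Finsupp.degree_single] at this
    have hev : ∀ j, 2 ≤ E j → ((∀ i, Even ((E - Finsupp.single j 2 : Fin n →₀ ℕ) i)) ↔ ∀ i, Even (E i)) := by
      intro j hj
      refine forall_congr' fun i => ?_
      by_cases hi : i = j
      · subst hi
        simp [Nat.even_sub hj]
      · simp [Finsupp.single_eq_of_ne hi]
    by_cases hE : (∀ i, Even (E i)) ∧ E.degree = 2 * (k + 1)
    · rw [if_pos hE]
      -- The powers are written as `1 - (1 - ·)` to match the telescoping identity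
      -- `prod_one_sub_ordered`.
      have hterm : ∀ j, (if 2 ≤ E j then
          weight q (fun i j : Fin n => if j < i then 1 else 0) (Finsupp.single j 2)
              (E - Finsupp.single j 2) *
            (if (∀ i, Even ((E - Finsupp.single j 2 : Fin n →₀ ℕ) i)) ∧
                (E - Finsupp.single j 2).degree = 2 * k then
              ((qPoch (q ^ 4) (q ^ 4) k /
                ∏ i, qPoch (q ^ 4) (q ^ 4) ((E - Finsupp.single j 2 : Fin n →₀ ℕ) i / 2) : ℝ) : ℂ) else 0)
          else 0) =
          ((qPoch (q ^ 4) (q ^ 4) k / (∏ i, qPoch (q ^ 4) (q ^ 4) (E i / 2)) *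
            ((1 - (q ^ 4) ^ (E j / 2)) * ∏ i with i < j, (1 - (1 - (q ^ 4) ^ (E i / 2)))) : ℝ) :
              ℂ) := by
        intro j
        split_ifs with hj h
        · rw [weight_cov_single]
          have h1 : (q : ℂ) ^ (2 * ∑ i with i < j, (E - Finsupp.single j 2 : Fin n →₀ ℕ) i) =
              ((∏ i with i < j, (1 - (1 - (q ^ 4) ^ (E i / 2))) : ℝ) : ℂ) := by
            simp only [sub_sub_cancel, prod_pow_eq_pow_sum]
            push_cast
            rw [← pow_mul, mul_sum, mul_sum]
            congr 1
            refine sum_congr rfl fun i hi => ?_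
            have hij : i ≠ j := (mem_filter.1 hi).2.ne
            have := Nat.div_mul_cancel (hE.1 i).two_dvd
            simp only [Pi.sub_apply, Finsupp.single_eq_of_ne hij, Nat.sub_zero]
            omega
          have h2 : (∏ i, qPoch (q ^ 4) (q ^ 4) (E i / 2)) =
              (1 - (q ^ 4) ^ (E j / 2)) *
                ∏ i, qPoch (q ^ 4) (q ^ 4) ((E - Finsupp.single j 2 : Fin n →₀ ℕ) i / 2) := by
            rw [← mul_prod_erase univ _ (mem_univ j), ← mul_prod_erase univ _ (mem_univ j),
              ← mul_assoc]
            congr 1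
            · obtain ⟨m, hm⟩ : ∃ m, E j / 2 = m + 1 := ⟨E j / 2 - 1, by omega⟩
              have : (E - Finsupp.single j 2 : Fin n →₀ ℕ) j / 2 = m := by
                simp only [Finsupp.coe_tsub, Pi.sub_apply, Finsupp.single_eq_same]
                omega
              rw [this, hm, qPoch_self_succ]
              ring
            · refine prod_congr rfl fun i hi => ?_
              simp [Finsupp.single_eq_of_ne (ne_of_mem_erase hi)]
          have h3 : 1 - (q ^ 4) ^ (E j / 2) ≠ 0 :=
            (sub_pos.2 (pow_lt_one₀ (by positivity) hp1 (by omega))).ne'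
          rw [h1, h2, ← Complex.ofReal_mul]
          congr 1
          have h4 : ∏ i, qPoch (q ^ 4) (q ^ 4) ((E - Finsupp.single j 2 : Fin n →₀ ℕ) i / 2) ≠ 0 :=
            prod_ne_zero_iff.2 fun i _ => hpos _
          field_simp
        · exact absurd ⟨(hev j hj).2 hE.1, by have := hdeg j hj; omega⟩ h
        · have : E j / 2 = 0 := by omega
          simp [this]
      rw [sum_congr rfl fun j _ => hterm j, ← Complex.ofReal_sum, ← mul_sum]
      congr 1
      have hsum := prod_one_sub_ordered univ fun i => 1 - (q ^ 4) ^ (E i / 2)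
      have hK : ∑ i, E i / 2 = k + 1 := by
        have h1 : E.degree = ∑ i, E i := Finsupp.degree_eq_sum E
        have h2 : ∑ i, E i = 2 * ∑ i, E i / 2 := by
          rw [mul_sum]
          exact sum_congr rfl fun i _ => (Nat.mul_div_cancel' (hE.1 i).two_dvd).symm
        have := hE.2
        omega
      have hprod : ∏ i, (1 - (1 - (q ^ 4) ^ (E i / 2))) = (q ^ 4) ^ (k + 1) := by
        simp only [sub_sub_cancel, prod_pow_eq_pow_sum, hK]
      rw [hprod] at hsum
      rw [show ∑ i, (1 - (q ^ 4) ^ (E i / 2)) * ∏ j with j < i, (1 - (1 - (q ^ 4) ^ (E j / 2))) =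
        1 - (q ^ 4) ^ (k + 1) by linarith, qPoch_self_succ]
      ring
    · rw [if_neg hE]
      refine sum_eq_zero fun j _ => ?_
      split_ifs with hj h
      · exact absurd ⟨(hev j hj).1 h.1, by have := hdeg j hj; omega⟩ hE
      · rw [mul_zero]
      · rfl

theorem totalGauss_eq_decProd (hq0 : 0 < q) (hq1 : q < 1) (n : ℕ) :
    totalGauss q n = decProd fun j => ofSeries j (bigGaussSeries (q ^ 2)) := by
  have hp1 : q ^ 4 < 1 := pow_lt_one₀ hq0.le hq1 (by norm_num)
  have hpos := fun k => (qPoch_pos hp1 (by positivity) hp1 k).ne'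
  refine TwistedSeries.ext fun E => ?_
  have hpow : ∀ k, (-((q : ℂ) ^ 4 • ∑ j, xv q j ^ 2) : CovExt q n) ^ k =
      (-(q : ℂ) ^ 4) ^ k • (∑ j, xv q j ^ 2) ^ k := fun k => by
    rw [← neg_smul, smul_pow]
  rw [totalGauss, subst_apply, decProd_ofSeries_apply, orderExponent_cov]
  simp only [hpow, smul_apply, sum_sq_pow_apply hq0 hq1]
  by_cases hE : ∀ i, Even (E i)
  · have h2 : ∀ i, E i = 2 * (E i / 2) := fun i => (Nat.mul_div_cancel' (hE i).two_dvd).symm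
    have hdeg : E.degree = 2 * ∑ i, E i / 2 := by
      rw [Finsupp.degree_eq_sum, mul_sum]
      exact sum_congr rfl fun i _ => h2 i
    rw [sum_eq_single (∑ i, E i / 2), if_pos ⟨hE, hdeg⟩]
    · have hw : weight q (fun i j : Fin n => if j < i then 1 else 0) E E =
          ((q ^ 4) ^ (∑ i, ∑ j, if j < i then E i / 2 * (E j / 2) else 0) : ℝ) := by
        push_cast
        rw [weight, ← pow_mul, mul_sum]
        congr 1
        refine sum_congr rfl fun i _ => ?_
        rw [mul_sum]
        refine sum_congr rfl fun j _ => ?_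
        split_ifs
        · nth_rw 1 [h2 i, h2 j]
          ring
        · simp
      have hc : ∀ i, coeff (E i) (bigGaussSeries (q ^ 2)) =
          (q ^ 4) ^ (E i / 2).choose 2 / qPoch (q ^ 4) (q ^ 4) (E i / 2) *
            (-q ^ 4) ^ (E i / 2) := fun i => by
        simp [bigGaussSeries, hE i, ← pow_mul]
      simp only [hw, hc]
      rw [← Complex.ofReal_prod, ← Complex.ofReal_mul, prod_mul_distrib, prod_div_distrib,
        prod_pow_eq_pow_sum, prod_pow_eq_pow_sum, bigExp, choose_two_sum]
      have h4 : ∏ i, qPoch (q ^ 4) (q ^ 4) (E i / 2) ≠ 0 := prod_ne_zero_iff.2 fun i _ => hpos _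
      have h5 := hpos (∑ i, E i / 2)
      rw [show -(q : ℂ) ^ 4 = ((-q ^ 4 : ℝ) : ℂ) by push_cast; rfl, ← Complex.ofReal_pow,
        ← Complex.ofReal_mul, ← Complex.ofReal_mul]
      congr 1
      rw [pow_add]
      field_simp
    · intro k _ hk
      rw [if_neg, mul_zero, mul_zero]
      rintro ⟨-, h⟩
      omega
    · intro h
      rw [mem_range] at h
      omega
  · rw [sum_eq_zero fun k _ => by rw [if_neg fun h => hE h.1, mul_zero, mul_zero]]
    push Not at hE
    obtain ⟨i, hi⟩ := hE
    rw [prod_eq_zero (mem_univ i), mul_zero]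
    simp [bigGaussSeries, hi]

/-! ### Gaussian type series -/

/-- Any finite set of exponents lies in a box, over which the sum factors. -/
theorem summable_finsupp_prod {f : Fin n → ℕ → ℝ} (hf0 : ∀ j e, 0 ≤ f j e)
    (hf : ∀ j, Summable (f j)) : Summable fun E : Fin n →₀ ℕ => ∏ j, f j (E j) := by
  rw [← Finsupp.equivFunOnFinite.symm.summable_iff]
  refine summable_of_sum_le (c := ∏ j, ∑' e, f j e) (fun E => prod_nonneg fun j _ => hf0 _ _)
    fun s => ?_
  calc ∑ E ∈ s, ∏ j, f j (E j)
      ≤ ∑ E ∈ Fintype.piFinset fun j => s.image fun E => E j, ∏ j, f j (E j) :=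
        sum_le_sum_of_subset_of_nonneg
          (fun E hE => Fintype.mem_piFinset.2 fun j => mem_image_of_mem _ hE)
          fun E _ _ => prod_nonneg fun j _ => hf0 _ _
    _ = ∏ j, ∑ e ∈ s.image fun E => E j, f j e := (prod_univ_sum _ _).symm
    _ ≤ ∏ j, ∑' e, f j e :=
        prod_le_prod (fun j _ => sum_nonneg fun e _ => hf0 _ _)
          fun j _ => (hf j).sum_le_tsum _ fun e _ => hf0 _ _

/-- The series with the coefficients
`C q ^ (∑_{j < i} e_i e_j) ∏_j D_j(e_j) q ^ (-ρ_j e_j)`. -/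
def gaussState (q : ℝ) (C : ℂ) (D : Fin n → ℝ⟦X⟧) (ρ : Fin n → ℕ) : CovExt q n := fun E =>
  C * (weight q (fun i j => if j < i then 1 else 0) E E *
    ∏ j, ((coeff (E j) (D j) : ℝ) : ℂ) * (q : ℂ)⁻¹ ^ (ρ j * E j))

theorem norm_weight_le_one (hq0 : 0 < q) (hq1 : q < 1) (B : Fin n → Fin n → ℕ)
    (E F : Fin n →₀ ℕ) : ‖weight q B E F‖ ≤ 1 := by
  rw [weight, norm_pow, Complex.norm_real, Real.norm_of_nonneg hq0.le]
  exact pow_le_one₀ hq0.le hq1.le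

section Summability

variable {C : ℂ} {D : Fin n → ℝ⟦X⟧} {ρ : Fin n → ℕ}

/-- The weight has norm at most 1 because `q < 1`, and `ρ` only rescales the variables, which entire
series tolerate. -/
theorem summable_norm_gaussState (hq0 : 0 < q) (hq1 : q < 1) (hD : ∀ j, EntireSeries (D j))
    (z : Fin n → ℂ) :
    Summable fun E : Fin n →₀ ℕ => ‖gaussState q C D ρ E * ∏ i, z i ^ E i‖ := by
  have h := (summable_finsupp_prod (n := n)
    (f := fun j e => ‖coeff e (D j)‖ * (q⁻¹ ^ ρ j * ‖z j‖) ^ e) (fun j e => by positivity)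
    fun j => hD j _ (by positivity)).mul_left ‖C‖
  refine h.of_nonneg_of_le (fun E => norm_nonneg _) fun E => ?_
  rw [gaussState, norm_mul, norm_mul, norm_mul, norm_prod, norm_prod, mul_assoc, mul_assoc,
    ← prod_mul_distrib]
  refine mul_le_mul_of_nonneg_left ?_ (norm_nonneg _)
  refine (mul_le_of_le_one_left (prod_nonneg fun j _ => by positivity)
    (norm_weight_le_one hq0 hq1 _ _ _)).trans_eq (prod_congr rfl fun j _ => ?_)
  simp only [norm_mul, norm_pow, norm_inv, Complex.norm_real, Real.norm_of_nonneg hq0.le, mul_pow,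
    pow_mul]
  ring

theorem isEntire_gaussState (hq0 : 0 < q) (hq1 : q < 1) (hD : ∀ j, EntireSeries (D j)) :
    IsEntire (gaussState q C D ρ) := fun z =>
  (summable_norm_gaussState hq0 hq1 hD z).of_norm

theorem isClassC_gaussState (hq0 : 0 < q) (hq1 : q < 1) (hD : ∀ j, EntireSeries (D j)) :
    IsClassC (gaussState q C D ρ) :=
  ⟨1, one_pos, by simpa using summable_norm_gaussState hq0 hq1 hD (C := C) (ρ := ρ) fun _ => 1⟩

theorem gaussState_eq_zero {E : Fin n →₀ ℕ} {j : Fin n} (h : coeff (E j) (D j) = 0) :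
    gaussState q C D ρ E = 0 := by
  rw [gaussState, prod_eq_zero (mem_univ j) (by simp [h]), mul_zero, mul_zero]

theorem evenPart_gaussState (hD : ∀ j, HasParity (D j) 0) :
    evenPart (gaussState q C D ρ) = gaussState q C D ρ := by
  refine TwistedSeries.ext fun E => ?_
  rw [evenPart]
  split_ifs with h
  · rfl
  · push Not at h
    obtain ⟨j, hj⟩ := h
    exact (gaussState_eq_zero (hD j _ hj)).symm

theorem evenPart_gaussState_eq_zero {j : Fin n} (hD : HasParity (D j) 1) :
    evenPart (gaussState q C D ρ) = 0 := by
  refine TwistedSeries.ext fun E => ?_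
  rw [evenPart, TwistedSeries.zero_apply]
  split_ifs with h
  · refine gaussState_eq_zero (j := j) (hD _ fun h' => ?_)
    have := h j
    rw [Nat.even_iff] at *
    omega
  · rfl

end Summability

/-! ### Integrating out one variable -/

/-- The term of index `t` of the integral of `ψ` over the lattice generated by `1`. -/
def latticeTerm (Q : ℝ) (ψ : ℝ⟦X⟧) (t : ℤ) : ℝ := 2 * (1 - Q) * (Q ^ t * seriesEval ψ (Q ^ t))

theorem hasSum_latticeMoment {Q : ℝ} (h0 : 0 < Q) (h1 : Q < 1) {ψ : ℝ⟦X⟧}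
    (hψ : LatticeSeries Q ψ) : HasSum (latticeTerm Q ψ) (latticeMoment Q ψ) := by
  have h := ((hψ.entire.summable_moment h0 h1).hasSum.mul_left (2 * (1 - Q)))
  have hneg : HasSum (fun t : ℕ => latticeTerm Q ψ (-((t : ℤ) + 1))) 0 := by
    convert hasSum_zero with t
    rw [latticeTerm, zpow_neg, ← Nat.cast_succ, zpow_natCast, hψ.eval_inv_pow, mul_zero, mul_zero]
  have := HasSum.of_nat_of_neg_add_one (f := latticeTerm Q ψ)
    (by simpa only [latticeTerm, zpow_natCast] using h) hneg
  rwa [add_zero] at this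

/-- Splitting off the exponent of the `l`-th variable. -/
def splitExponent (l : Fin n) : {E : Fin n →₀ ℕ // E l = 0} × ℕ ≃ (Fin n →₀ ℕ) where
  toFun x := x.1.1 + Finsupp.single l x.2
  invFun E := (⟨E.erase l, Finsupp.erase_same⟩, E l)
  left_inv := by
    rintro ⟨⟨E, hE⟩, m⟩
    have h1 : (E + Finsupp.single l m).erase l = E := by
      rw [Finsupp.erase_add, Finsupp.erase_single, add_zero,
        Finsupp.erase_of_notMem_support (by simpa using hE)]
    simp [h1, hE]
  right_inv E := Finsupp.erase_add_single l E

/-- The sum of the exponents of the variables before the `l`-th. -/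
def degBefore (l : Fin n) (E : Fin n →₀ ℕ) : ℕ := ∑ i with i < l, E i

/-- The sum of the exponents of the variables after the `l`-th. -/
def degAfter (l : Fin n) (E : Fin n →₀ ℕ) : ℕ := ∑ i with l < i, E i

theorem weight_cov_single_right (j : Fin n) (m : ℕ) (F : Fin n →₀ ℕ) :
    weight q (fun i j : Fin n => if j < i then 1 else 0) F (Finsupp.single j m) =
      (q : ℂ) ^ (m * degAfter j F) := by
  unfold weight degAfter
  rw [sum_comm, sum_eq_single j, mul_sum, sum_filter]
  · congr 1
    refine sum_congr rfl fun i _ => ?_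
    split_ifs with h <;> simp [h, mul_comm]
  · intro i _ hi
    simp [Finsupp.single_eq_of_ne hi]
  · simp

theorem weight_cov_add_single (l : Fin n) (m : ℕ) (E : Fin n →₀ ℕ) :
    weight q (fun i j : Fin n => if j < i then 1 else 0) (E + Finsupp.single l m)
      (E + Finsupp.single l m) =
    weight q (fun i j : Fin n => if j < i then 1 else 0) E E *
      ((q : ℂ) ^ degBefore l E * (q : ℂ) ^ degAfter l E) ^ m := by
  rw [weight_add_left, weight_add_right, weight_add_right, weight_single_single (by simp),
    weight_cov_single, weight_cov_single_right, mul_pow, ← pow_mul, ← pow_mul, degBefore,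
    mul_comm m, mul_comm m]
  ring

/-- The point at which the terms of the integral over the `l`-th variable are evaluated. -/
def integralPoint (q : ℝ) (l : Fin n) (y : ℂ) (z : Fin n → ℂ) (i : Fin n) : ℂ :=
  if i < l then (q : ℂ)⁻¹ * z i else if i = l then y else z i

theorem prod_integralPoint (l : Fin n) (y : ℂ) (z : Fin n → ℂ) (E : Fin n →₀ ℕ) :
    ∏ i, integralPoint q l y z i ^ E i =
      y ^ E l * ((q : ℂ)⁻¹ ^ degBefore l E * ∏ i ∈ univ.erase l, z i ^ E i) := by
  rw [← mul_prod_erase univ _ (mem_univ l)]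
  congr 1
  · simp [integralPoint]
  · have h1 : ∀ i ∈ univ.erase l, integralPoint q l y z i ^ E i =
        (if i < l then (q : ℂ)⁻¹ ^ E i else 1) * z i ^ E i := by
      intro i hi
      have := ne_of_mem_erase hi
      unfold integralPoint
      split_ifs
      · rw [mul_pow]
      · rw [one_mul]
    rw [prod_congr rfl h1, prod_mul_distrib, degBefore, ← prod_pow_eq_pow_sum, prod_filter,
      ← mul_prod_erase univ _ (mem_univ l), if_neg (lt_irrefl l), one_mul]

theorem prod_shiftAt (l : Fin n) (t : ℂ) (E : Fin n →₀ ℕ) :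
    ∏ i, (if i < l then (q : ℂ)⁻¹ ^ 2 else if i = l then t else 1) ^ E i =
      t ^ E l * ((q : ℂ)⁻¹ ^ degBefore l E) ^ 2 := by
  rw [← mul_prod_erase univ _ (mem_univ l)]
  congr 1
  · simp
  · have h1 : ∀ i ∈ univ.erase l, (if i < l then (q : ℂ)⁻¹ ^ 2 else if i = l then t else 1) ^ E i =
        (if i < l then ((q : ℂ)⁻¹ ^ 2) ^ E i else 1) := by
      intro i hi
      have := ne_of_mem_erase hi
      split_ifs <;> simp
    rw [prod_congr rfl h1, ← pow_mul, mul_comm, pow_mul, degBefore, ← prod_pow_eq_pow_sum,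
      prod_filter, ← mul_prod_erase univ _ (mem_univ l), if_neg (lt_irrefl l), one_mul]

/-- Moving `x_l` past the earlier variables gives `q` for each of them, while the shift in the
integral gives `q⁻²`; the net `q⁻¹` is the scaling in `integralPoint`. The two signs agree on even
exponents, whence the factor 2. -/
theorem evalOne_integralTerm (hq0 : 0 < q) {f : CovExt q n}
    (hf : ∀ (E : Fin n →₀ ℕ) i, ¬ Even (E i) → f E = 0) (l : Fin n) (h : ℤ) (g : ℂ)
    (z : Fin n → ℂ) :
    evalOne (integralTerm l f h) (Function.update z l g) =
      ∑' E : Fin n →₀ ℕ, 2 * (1 - (q : ℂ) ^ 2) * ((q : ℂ) ^ (2 * h) * g) *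
        (f E * ∏ i, integralPoint q l ((q : ℂ) ^ (2 * h) * g) z i ^ E i) := by
  have hinj : Function.Injective fun E : Fin n →₀ ℕ => E + Finsupp.single l 1 :=
    fun a b hab => add_right_cancel hab
  have hq : (q : ℂ) ≠ 0 := by exact_mod_cast hq0.ne'
  have happ : ∀ E, integralTerm l f h E = (1 - (q : ℂ) ^ 2) * (q : ℂ) ^ (2 * h) *
      if Finsupp.single l 1 ≤ E then
        weight q (fun i j : Fin n => if j < i then 1 else 0) (Finsupp.single l 1)
          (E - Finsupp.single l 1) * ((shiftAt l ((q : ℂ) ^ (2 * h)) f +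
            shiftAt l (-(q : ℂ) ^ (2 * h)) f) (E - Finsupp.single l 1)) else 0 := fun E => by
    rw [← mono_mul_apply]
    rfl
  unfold evalOne
  rw [← hinj.tsum_eq]
  · refine tsum_congr fun E => ?_
    rw [happ, if_pos le_add_self, add_tsub_cancel_right, weight_cov_single,
      TwistedSeries.add_apply, shiftAt, shiftAt, rescale, rescale, prod_shiftAt, prod_shiftAt,
      prod_integralPoint, ← mul_prod_erase univ _ (mem_univ l), Function.update_self]
    have hp : ∏ i ∈ univ.erase l, Function.update z l g i ^ (E + Finsupp.single l 1 : Fin n →₀ ℕ) i =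
        ∏ i ∈ univ.erase l, z i ^ E i := prod_congr rfl fun i hi => by
      rw [Function.update_of_ne (ne_of_mem_erase hi)]
      simp [Finsupp.single_eq_of_ne (ne_of_mem_erase hi)]
    rw [hp]
    by_cases hE : Even (E l)
    · rw [hE.neg_pow, one_mul, ← degBefore]
      have hcancel : (q : ℂ) ^ degBefore l E * (q : ℂ)⁻¹ ^ degBefore l E = 1 := by
        rw [← mul_pow, mul_inv_cancel₀ hq, one_pow]
      simp only [Finsupp.coe_add, Pi.add_apply, Finsupp.single_eq_same, pow_succ, mul_pow]
      linear_combination (2 * (1 - (q : ℂ) ^ 2) * (q : ℂ) ^ (2 * h) * f E *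
        ((q : ℂ) ^ (2 * h)) ^ E l * (q : ℂ)⁻¹ ^ degBefore l E * g ^ E l * g *
          ∏ i ∈ univ.erase l, z i ^ E i) * hcancel
    · rw [hf E l hE]
      ring
  · intro E hE
    by_contra hE'
    refine hE ?_
    simp only
    rw [happ, if_neg, mul_zero, zero_mul]
    intro hle
    exact hE' ⟨E - Finsupp.single l 1, tsub_add_cancel_of_le hle⟩

theorem entireSeries_one : EntireSeries 1 := fun r _ =>
  summable_of_ne_finset_zero (s := {0}) fun e he => by
    rw [coeff_one, if_neg (by simpa using he), norm_zero, zero_mul]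

theorem hasParity_one : HasParity 1 0 := fun e he => by
  rw [coeff_one, if_neg]
  rintro rfl
  exact he (by simp)

section Step

variable {C : ℂ} {D : Fin n → ℝ⟦X⟧} {ρ ρ' : Fin n → ℕ} {l : Fin n}

/-- With the other exponents fixed, what depends on `m` is the term of `D l` at a point dilated by
`q^{before + after - ρ_l}`. -/
theorem gaussState_add_single {E : Fin n →₀ ℕ} (hE : E l = 0) (m : ℕ) (y : ℂ) (z : Fin n → ℂ) :
    gaussState q C D ρ (E + Finsupp.single l m) *
        ∏ i, integralPoint q l y z i ^ (E + Finsupp.single l m : Fin n →₀ ℕ) i =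
      C * weight q (fun i j => if j < i then 1 else 0) E E *
        (∏ j ∈ univ.erase l, ((coeff (E j) (D j) : ℝ) : ℂ) * (q : ℂ)⁻¹ ^ (ρ j * E j) *
          z j ^ E j) * (q : ℂ)⁻¹ ^ degBefore l E *
        (((coeff m (D l) : ℝ) : ℂ) *
          ((q : ℂ) ^ degBefore l E * (q : ℂ) ^ degAfter l E * (q : ℂ)⁻¹ ^ ρ l * y) ^ m) := by
  have hl : (E + Finsupp.single l m : Fin n →₀ ℕ) l = m := by simp [hE]
  have hne : ∀ i ∈ univ.erase l, (E + Finsupp.single l m : Fin n →₀ ℕ) i = E i := fun i hi => by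
    simp [Finsupp.single_eq_of_ne (ne_of_mem_erase hi)]
  have hb : degBefore l (E + Finsupp.single l m) = degBefore l E :=
    sum_congr rfl fun i hi => hne i (mem_erase.2 ⟨(mem_filter.1 hi).2.ne, mem_univ i⟩)
  rw [prod_integralPoint, gaussState, weight_cov_add_single, ← mul_prod_erase univ _ (mem_univ l),
    hl, hb, prod_congr rfl fun i hi => by rw [hne i hi],
    prod_congr (f := fun i => z i ^ (E + Finsupp.single l m : Fin n →₀ ℕ) i) rfl fun i hi => by
      rw [hne i hi], prod_mul_distrib (g := fun j => z j ^ E j), pow_mul, mul_pow _ y, mul_pow]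
  ring

/-- The increments of `ρ` absorb two effects: the inverse dilation `q^{-(before + after)}`, and a
further `q^{-before}` from `integralPoint`. Hence 1 for later and 2 for earlier variables. -/
theorem gaussState_update_one (z : Fin n → ℂ) {E : Fin n →₀ ℕ} (hE : E l = 0)
    (hgt : ∀ i, l < i → ρ' i = ρ i + 1) (hlt : ∀ i, i < l → ρ' i = ρ i + 2) :
    gaussState q C (Function.update D l 1) ρ' E * ∏ i, z i ^ E i =
      C * weight q (fun i j => if j < i then 1 else 0) E E *
        (∏ j ∈ univ.erase l, ((coeff (E j) (D j) : ℝ) : ℂ) * (q : ℂ)⁻¹ ^ (ρ j * E j) *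
          z j ^ E j) * ((q : ℂ)⁻¹ ^ degBefore l E) ^ 2 * (q : ℂ)⁻¹ ^ degAfter l E := by
  have h1 : ((q : ℂ)⁻¹ ^ degBefore l E) ^ 2 * (q : ℂ)⁻¹ ^ degAfter l E =
      ∏ j ∈ univ.erase l, ((if j < l then (q : ℂ)⁻¹ ^ (2 * E j) else 1) *
        if l < j then (q : ℂ)⁻¹ ^ E j else 1) := by
    rw [prod_mul_distrib, degBefore, degAfter, ← prod_pow_eq_pow_sum, ← prod_pow_eq_pow_sum,
      prod_filter, prod_filter, ← mul_prod_erase univ _ (mem_univ l), if_neg (lt_irrefl l), one_mul,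
      ← mul_prod_erase univ (fun j => if l < j then _ else _) (mem_univ l), if_neg (lt_irrefl l),
      one_mul, ← prod_pow]
    congr 1
    refine prod_congr rfl fun j _ => ?_
    split_ifs
    · rw [← pow_mul, mul_comm]
    · rw [one_pow]
  have h2 : (∏ j, ((coeff (E j) (Function.update D l 1 j) : ℝ) : ℂ) * (q : ℂ)⁻¹ ^ (ρ' j * E j)) *
      ∏ i, z i ^ E i =
      (∏ j ∈ univ.erase l, ((coeff (E j) (D j) : ℝ) : ℂ) * (q : ℂ)⁻¹ ^ (ρ j * E j) * z j ^ E j) *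
        (((q : ℂ)⁻¹ ^ degBefore l E) ^ 2 * (q : ℂ)⁻¹ ^ degAfter l E) := by
    rw [h1, ← prod_mul_distrib, ← prod_mul_distrib, ← mul_prod_erase univ _ (mem_univ l)]
    rw [hE, Function.update_self]
    simp only [coeff_zero_eq_constantCoeff, map_one, Complex.ofReal_one, mul_zero, pow_zero,
      mul_one, one_mul]
    refine prod_congr rfl fun j hj => ?_
    have hj := ne_of_mem_erase hj
    rw [Function.update_of_ne hj]
    rcases lt_or_gt_of_ne hj with h | h
    · rw [hlt j h, if_pos h, if_neg h.not_gt, add_mul, pow_add]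
      ring
    · rw [hgt j h, if_pos h, if_neg h.not_gt, add_mul, pow_add, one_mul]
      ring
  rw [gaussState]
  linear_combination (C * weight q (fun i j => if j < i then 1 else 0) E E) * h2

/-- The exponent by which the lattice of the `l`-th variable is shifted. -/
def latticeOffset (g r : ℕ) (l : Fin n) (E : Fin n →₀ ℕ) : ℤ :=
  (degBefore l E + degAfter l E + g - r) / 2

/-- The dilated point is `Q^{h+d}` with `d` the lattice offset. The prefactor `q^{2h+g}` differs
from it by `q^{ρ_l - before - after}`, which supplies `q^{ρ_l}` and part of the change from `ρ` to
`ρ'`. -/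
theorem hasSum_fiber (hq0 : 0 < q) (hl : EntireSeries (D l)) (hpar : ∀ j, HasParity (D j) 0)
    {g : ℕ} (hg : Even (g + ρ l))
    (hgt : ∀ i, l < i → ρ' i = ρ i + 1) (hlt : ∀ i, i < l → ρ' i = ρ i + 2) (z : Fin n → ℂ) (h : ℤ)
    {E : Fin n →₀ ℕ} (hE : E l = 0) :
    HasSum (fun m : ℕ => 2 * (1 - (q : ℂ) ^ 2) * ((q : ℂ) ^ (2 * h) * (q : ℂ) ^ g) *
      (gaussState q C D ρ (E + Finsupp.single l m) *
        ∏ i, integralPoint q l ((q : ℂ) ^ (2 * h) * (q : ℂ) ^ g) z i ^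
          (E + Finsupp.single l m : Fin n →₀ ℕ) i))
      ((q : ℂ) ^ ρ l * (gaussState q C (Function.update D l 1) ρ' E * (∏ i, z i ^ E i) *
        (latticeTerm (q ^ 2) (D l) (h + latticeOffset g (ρ l) l E) : ℂ))) := by
  have hq : (q : ℂ) ≠ 0 := by exact_mod_cast hq0.ne'
  simp only [gaussState_add_single hE, gaussState_update_one z hE hgt hlt]
  by_cases hEe : ∀ j, Even (E j)
  · have hSe : Even (degBefore l E) := even_sum _ fun i _ => hEe i
    have hTe : Even (degAfter l E) := even_sum _ fun i _ => hEe i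
    -- The division by two is exact only through the parities of the exponents and of `g + ρ l`.
    have hdE : 2 * latticeOffset g (ρ l) l E = degBefore l E + degAfter l E + g - ρ l := by
      rw [latticeOffset]
      rw [Nat.even_iff] at hSe hTe hg
      omega
    generalize latticeOffset g (ρ l) l E = d at *
    have hy : (((q ^ 2) ^ (h + d) : ℝ) : ℂ) = (q : ℂ) ^ degBefore l E *
        (q : ℂ) ^ degAfter l E * (q : ℂ)⁻¹ ^ ρ l * ((q : ℂ) ^ (2 * h) * (q : ℂ) ^ g) := by
      push_cast
      rw [← zpow_natCast (q : ℂ) 2, ← zpow_mul, Nat.cast_ofNat, mul_add, zpow_add₀ hq, hdE,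
        zpow_sub₀ hq, zpow_add₀ hq, zpow_add₀ hq]
      simp only [zpow_natCast, inv_pow]
      field_simp
    have hser : HasSum (fun m => ((coeff m (D l) : ℝ) : ℂ) * (((q ^ 2) ^ (h + d) : ℝ) : ℂ) ^ m)
        (seriesEval (D l) ((q ^ 2) ^ (h + d)) : ℂ) := by
      have := (Complex.hasSum_ofReal (x := seriesEval (D l) ((q ^ 2) ^ (h + d)))).2
        (hl.summable ((q ^ 2) ^ (h + d))).hasSum
      simpa only [Complex.ofReal_mul, Complex.ofReal_pow] using this
    rw [latticeTerm, Complex.ofReal_mul, Complex.ofReal_mul ((q ^ 2) ^ (h + d))]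
    generalize (seriesEval (D l) ((q ^ 2) ^ (h + d)) : ℂ) = S at *
    rw [hy] at hser ⊢
    push_cast
    have c1 : (q : ℂ) ^ degBefore l E * (q : ℂ)⁻¹ ^ degBefore l E = 1 := by
      rw [← mul_pow, mul_inv_cancel₀ hq, one_pow]
    have c2 : (q : ℂ) ^ degAfter l E * (q : ℂ)⁻¹ ^ degAfter l E = 1 := by
      rw [← mul_pow, mul_inv_cancel₀ hq, one_pow]
    have c3 : (q : ℂ) ^ ρ l * (q : ℂ)⁻¹ ^ ρ l = 1 := by
      rw [← mul_pow, mul_inv_cancel₀ hq, one_pow]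
    generalize (∏ j ∈ univ.erase l, ((coeff (E j) (D j) : ℝ) : ℂ) * (q : ℂ)⁻¹ ^ (ρ j * E j) *
        z j ^ E j) = P at *
    generalize weight q (fun i j : Fin n => if j < i then 1 else 0) E E = W at *
    generalize (q : ℂ) ^ degBefore l E = a1 at *
    generalize (q : ℂ)⁻¹ ^ degBefore l E = a2 at *
    generalize (q : ℂ) ^ degAfter l E = b1 at *
    generalize (q : ℂ)⁻¹ ^ degAfter l E = b2 at *
    generalize (q : ℂ) ^ ρ l = e1 at *
    generalize (q : ℂ)⁻¹ ^ ρ l = e2 at *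
    generalize (q : ℂ) ^ (2 * h) * (q : ℂ) ^ g = x at *
    have hfin := hser.mul_left (2 * (1 - (q : ℂ) ^ 2) * x * (C * W * P * a2))
    have hval : e1 * (C * W * P * a2 ^ 2 * b2 * (2 * (1 - (q : ℂ) ^ 2) *
        (a1 * b1 * e2 * x * S))) = 2 * (1 - (q : ℂ) ^ 2) * x * (C * W * P * a2) * S := by
      trans (a1 * a2) * (b1 * b2) * (e1 * e2) *
        (2 * (1 - (q : ℂ) ^ 2) * x * (C * W * P * a2) * S)
      · ring
      · rw [c1, c2, c3]
        ring
    rw [hval]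
    simpa only [mul_assoc] using hfin
  -- An odd exponent makes a coefficient of some `D j` zero, so both sides vanish whatever the
  -- offset is.
  · push Not at hEe
    obtain ⟨j, hj⟩ := hEe
    have hjl : j ≠ l := by
      rintro rfl
      exact hj (by simp [hE])
    have hP : (∏ j ∈ univ.erase l, ((coeff (E j) (D j) : ℝ) : ℂ) * (q : ℂ)⁻¹ ^ (ρ j * E j) *
        z j ^ E j) = 0 :=
      prod_eq_zero (mem_erase.2 ⟨hjl, mem_univ j⟩) (by
        rw [hpar j _ (by simpa using hj), Complex.ofReal_zero, zero_mul, zero_mul])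
    simp only [hP, mul_zero, zero_mul, hasSum_zero]

theorem entireSeries_update_one (hD : ∀ j, EntireSeries (D j)) (j : Fin n) :
    EntireSeries (Function.update D l 1 j) := by
  by_cases hj : j = l
  · subst hj
    simpa using entireSeries_one
  · simpa [Function.update_of_ne hj] using hD j

theorem gaussState_update_one_eq_zero {E : Fin n →₀ ℕ} (hE : E l ≠ 0) :
    gaussState q C (Function.update D l 1) ρ' E = 0 :=
  gaussState_eq_zero (j := l) (by rw [Function.update_self, coeff_one, if_neg hE])

/-- Translating `ℤ` by an amount depending on `E` is a bijection of `ℤ × ι`, so the absolutely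
convergent double sum is unchanged. -/
theorem hasSum_shifted_prod {ι : Type*} {G : ι → ℂ} {u : ℤ → ℂ} {m : ℂ}
    (hG : Summable fun E => ‖G E‖) (hu : HasSum u m) (c : ℂ) (d : ι → ℤ) :
    HasSum (fun x : ℤ × ι => c * (G x.2 * u (x.1 + d x.2))) (c * ((∑' E, G E) * m)) := by
  have h1 : HasSum (fun x : ι × ℤ => G x.1 * u x.2) ((∑' E, G E) * m) :=
    hG.of_norm.hasSum.mul hu (summable_mul_of_summable_norm hG hu.summable.norm)
  exact (((Equiv.prodComm ℤ ι).trans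
    (Equiv.prodShear (Equiv.refl ι) fun E => Equiv.addRight (d E))).hasSum_iff.2 h1).mul_left c

/-- The double sum over the lattice and the exponents of the remaining variables. -/
theorem hasSum_lattice_prod (hq0 : 0 < q) (hq1 : q < 1) (hD : ∀ j, EntireSeries (D j))
    (hl : LatticeSeries (q ^ 2) (D l)) (c : ℂ) (d : (Fin n →₀ ℕ) → ℤ) (z : Fin n → ℂ) :
    HasSum (fun x : ℤ × (Fin n →₀ ℕ) =>
      c * (gaussState q C (Function.update D l 1) ρ' x.2 * (∏ i, z i ^ x.2 i) *
        (latticeTerm (q ^ 2) (D l) (x.1 + d x.2) : ℂ)))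
      (evalOne (gaussState q (C * (c * (latticeMoment (q ^ 2) (D l) : ℂ)))
        (Function.update D l 1) ρ') z) := by
  have hQ1 : q ^ 2 < 1 := pow_lt_one₀ hq0.le hq1 two_ne_zero
  have hus : HasSum (fun t => (latticeTerm (q ^ 2) (D l) t : ℂ))
      (latticeMoment (q ^ 2) (D l) : ℂ) :=
    Complex.hasSum_ofReal.2 (hasSum_latticeMoment (by positivity) hQ1 hl)
  have hGs := summable_norm_gaussState (C := C) (ρ := ρ') hq0 hq1
    (entireSeries_update_one (l := l) hD) z
  convert hasSum_shifted_prod hGs hus c d using 1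
  rw [evalOne, ← tsum_mul_right, ← tsum_mul_left]
  refine tsum_congr fun E => ?_
  simp only [gaussState]
  ring

theorem hasSum_split {f F : (Fin n →₀ ℕ) → ℂ} (hf : Summable f) (hF0 : ∀ E, E l ≠ 0 → F E = 0)
    (hF : ∀ E, E l = 0 → HasSum (fun m => f (E + Finsupp.single l m)) (F E)) :
    HasSum F (∑' E, f E) := by
  have h1 : HasSum (fun x => f (splitExponent l x)) (∑' E, f E) :=
    (splitExponent l).hasSum_iff.2 hf.hasSum
  have h2 : HasSum (fun E : {E : Fin n →₀ ℕ // E l = 0} => F E) (∑' E, f E) :=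
    h1.prod_fiberwise fun E => hF E.1 E.2
  refine (hasSum_subtype_iff_of_support_subset (s := {E : Fin n →₀ ℕ | E l = 0})
    fun E hE => ?_).1 h2
  by_contra hE'
  exact hE (hF0 E hE')

/-- The integral over one of the variables of a Gaussian type series is again of this kind. -/
theorem isPartialIntegral_gaussState (hq0 : 0 < q) (hq1 : q < 1) (hD : ∀ j, EntireSeries (D j))
    (hpar : ∀ j, HasParity (D j) 0) (hl : LatticeSeries (q ^ 2) (D l)) {γ : Fin n → ℝ} {g : ℕ}
    (hγ : γ l = q ^ g) (hg : Even (g + ρ l))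
    (hgt : ∀ i, l < i → ρ' i = ρ i + 1) (hlt : ∀ i, i < l → ρ' i = ρ i + 2) :
    IsPartialIntegral γ l (gaussState q C D ρ)
      (gaussState q (C * ((q : ℂ) ^ ρ l * (latticeMoment (q ^ 2) (D l) : ℂ)))
        (Function.update D l 1) ρ') := by
  have hev := evenPart_gaussState (q := q) (C := C) (ρ := ρ) hpar
  refine ⟨by rw [hev]; exact isEntire_gaussState hq0 hq1 hD,
    isEntire_gaussState hq0 hq1 (entireSeries_update_one hD),
    fun E => gaussState_update_one_eq_zero, fun z => ?_⟩
  rw [hev]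
  have htotal := hasSum_lattice_prod (C := C) (ρ' := ρ') hq0 hq1 hD hl ((q : ℂ) ^ ρ l)
    (latticeOffset g (ρ l) l) z
  -- Fubini: the double sum over `h` and `E` is known, so it is enough to identify the inner sum
  -- over `E` for fixed `h` with the `h`-th integral term.
  refine HasSum.prod_fiberwise htotal fun h => ?_
  rw [evalOne_integralTerm hq0 fun E i hE => gaussState_eq_zero (hpar i _ (by simpa using hE)), hγ,
    Complex.ofReal_pow]
  have hterm := (summable_norm_gaussState (C := C) (ρ := ρ) hq0 hq1 hD
    (integralPoint q l ((q : ℂ) ^ (2 * h) * (q : ℂ) ^ g) z)).of_norm.mul_left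
      (2 * (1 - (q : ℂ) ^ 2) * ((q : ℂ) ^ (2 * h) * (q : ℂ) ^ g))
  refine hasSum_split (l := l) hterm (fun E hE => ?_) fun E hE => ?_
  · rw [gaussState_update_one_eq_zero hE, zero_mul, zero_mul, mul_zero]
  · exact hasSum_fiber (C := C) hq0 (hD l) hpar hg hgt hlt z h hE

end Step

/-! ### Uniqueness of the iterated integral -/

theorem coeff_eq_zero_of_hasSum_zero {c : ℕ → ℂ} (h : ∀ t : ℂ, HasSum (fun d => t ^ d * c d) 0)
    (d : ℕ) : c d = 0 := by
  set p : FormalMultilinearSeries ℂ ℂ ℂ := fun d =>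
    ContinuousMultilinearMap.mkPiRing ℂ (Fin d) (c d) with hp
  have hc : ∀ d, p.coeff d = c d := fun d => by simp [hp, FormalMultilinearSeries.coeff]
  have hf : HasFPowerSeriesAt (0 : ℂ → ℂ) p 0 := by
    rw [hasFPowerSeriesAt_iff]
    exact Filter.Eventually.of_forall fun t => by simpa [hc] using h t
  rw [← hc, hf.eq_zero]
  simp [FormalMultilinearSeries.coeff]

/-- Substituting `t z` and expanding in `t` isolates each homogeneous part, a polynomial vanishing
on all of `ℂ^n`. -/
theorem eq_zero_of_tsum_eq_zero {f : (Fin n →₀ ℕ) → ℂ}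
    (hf : ∀ z : Fin n → ℂ, HasSum (fun E : Fin n →₀ ℕ => f E * ∏ i, z i ^ E i) 0)
    (E : Fin n →₀ ℕ) : f E = 0 := by
  set s : Finset (Fin n →₀ ℕ) := finsuppAntidiag univ E.degree with hs
  have hmem : ∀ F, F ∈ s ↔ F.degree = E.degree := fun F => by
    simp [hs, Finsupp.degree_eq_sum]
  have hpre : (Finsupp.degree ⁻¹' {E.degree} : Set (Fin n →₀ ℕ)) = (s : Set (Fin n →₀ ℕ)) := by
    ext F
    simp [hmem]
  have hzero : ∀ z : Fin n → ℂ, ∑ F ∈ s, f F * ∏ i, z i ^ F i = 0 := fun z => by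
    have key : ∀ t : ℂ, HasSum (fun d => t ^ d *
        ∑' F : (Finsupp.degree ⁻¹' {d} : Set (Fin n →₀ ℕ)), f F * ∏ i, z i ^ (F : Fin n →₀ ℕ) i) 0 := by
      intro t
      have h := (hf fun i => t * z i).tsum_fiberwise Finsupp.degree
      refine h.congr_fun fun d => ?_
      rw [← tsum_mul_left]
      refine tsum_congr fun F => ?_
      have hF : (F : Fin n →₀ ℕ).degree = d := F.2
      simp only [mul_pow, prod_mul_distrib, prod_pow_eq_pow_sum]
      rw [← Finsupp.degree_eq_sum, hF]
      ring
    have := coeff_eq_zero_of_hasSum_zero key E.degree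
    rw [hpre] at this
    rwa [Finset.tsum_subtype' s fun F => f F * ∏ i, z i ^ F i] at this
  have hp : ∑ F ∈ s, MvPolynomial.monomial F (f F) = 0 := by
    refine MvPolynomial.funext fun z => ?_
    rw [map_sum, map_zero, ← hzero z]
    refine sum_congr rfl fun F _ => ?_
    rw [MvPolynomial.eval_monomial, Finsupp.prod_fintype _ _ fun i => pow_zero _]
  have := congrArg (MvPolynomial.coeff E) hp
  rw [MvPolynomial.coeff_sum, MvPolynomial.coeff_zero, sum_eq_single E] at this
  · simpa using this
  · intro F _ hF
    rw [MvPolynomial.coeff_monomial, if_neg hF]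
  · intro h
    exact absurd ((hmem E).2 rfl) h

theorem eq_of_evalOne_eq {f g : CovExt q n} (hf : IsEntire f) (hg : IsEntire g)
    (h : ∀ z, evalOne f z = evalOne g z) : f = g := by
  refine TwistedSeries.ext fun E => sub_eq_zero.1 ?_
  refine eq_zero_of_tsum_eq_zero (f := fun E => f E - g E) (fun z => ?_) E
  have := (hf z).hasSum.sub (hg z).hasSum
  have hz : ∑' E : Fin n →₀ ℕ, f E * ∏ i, z i ^ E i = ∑' E : Fin n →₀ ℕ, g E * ∏ i, z i ^ E i := h z
  rw [hz, sub_self] at this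
  simpa only [sub_mul] using this

/-- The iterated integral is well defined because of this, and the value chosen in `loIntegral` can
be computed from any chain of partial integrals. -/
theorem IsPartialIntegral.unique {γ : Fin n → ℝ} {l : Fin n} {f g g' : CovExt q n}
    (h : IsPartialIntegral γ l f g) (h' : IsPartialIntegral γ l f g') : g = g' :=
  eq_of_evalOne_eq h.entire_right h'.entire_right fun z => (h.hasSum z).unique (h'.hasSum z)

theorem HasLOIntegral.unique {σ : Equiv.Perm (Fin n)} {γ : Fin n → ℝ} {f : CovExt q n} {c c' : ℂ}
    (h : HasLOIntegral σ γ f c) (h' : HasLOIntegral σ γ f c') : c = c' := by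
  obtain ⟨g, h0, hs, hl⟩ := h
  obtain ⟨g', h0', hs', hl'⟩ := h'
  have hg : ∀ k, g k = g' k := fun k => by
    induction k using Fin.induction with
    | zero => rw [h0, h0']
    | succ k ih => exact (hs k).unique (ih ▸ hs' k)
  have := congrFun (hl.symm.trans ((hg _).trans hl')) 0
  simpa [TwistedSeries.smul_apply, TwistedSeries.one_apply] using this

theorem HasLOIntegral.loIntegral_eq {σ : Equiv.Perm (Fin n)} {γ : Fin n → ℝ} {f : CovExt q n}
    {c : ℂ} (h : HasLOIntegral σ γ f c) : loIntegral σ γ f = c := by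
  have he : ∃ c, HasLOIntegral σ γ f c := ⟨c, h⟩
  rw [loIntegral, dif_pos he]
  exact he.choose_spec.unique h

/-! ### Iterated integrals of Gaussian type series -/

theorem isPartialIntegral_zero {γ : Fin n → ℝ} {l : Fin n} {f : CovExt q n} (hf : evenPart f = 0) :
    IsPartialIntegral γ l f 0 := by
  have h0 : IsEntire (0 : CovExt q n) := fun z => by
    simp [TwistedSeries.zero_apply]
  have he : ∀ z, evalOne (0 : CovExt q n) z = 0 := fun z => by
    simp [evalOne, TwistedSeries.zero_apply]
  refine ⟨by rwa [hf], h0, fun _ _ => rfl, fun z => ?_⟩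
  have hs : ∀ t : ℂ, shiftAt l t (0 : CovExt q n) = 0 := fun t => TwistedSeries.ext fun E => by
    simp [shiftAt, rescale, TwistedSeries.zero_apply]
  have hi : ∀ h, integralTerm l (0 : CovExt q n) h = 0 := fun h => by
    rw [integralTerm, hs, hs, add_zero, mul_zero, smul_zero]
  simp only [hf, hi, he, hasSum_zero]

theorem hasLOIntegral_zero {f : CovExt q n} (hf : evenPart f = 0) (j : Fin n)
    (σ : Equiv.Perm (Fin n)) (γ : Fin n → ℝ) : HasLOIntegral σ γ f 0 := by
  refine ⟨fun k => if k = 0 then f else 0, if_pos rfl, fun k => ?_, ?_⟩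
  · simp only [Fin.succ_ne_zero, if_false]
    split_ifs
    · exact isPartialIntegral_zero hf
    · exact isPartialIntegral_zero (TwistedSeries.ext fun E => by
        simp [evenPart, TwistedSeries.zero_apply])
  -- The index `j` guarantees `n > 0`: without any integration the odd series `f` would not be
  -- replaced by zero.
  · have : Fin.last n ≠ 0 := by
      have := j.pos
      simp [Fin.ext_iff]
      omega
    simp only [this, if_false, zero_smul]

section Chain

variable (σ : Equiv.Perm (Fin n))

/-- The scaling exponents after the integration over `x_{σ(1)}, …, x_{σ(k)}`. -/
def scalingExponent (r : Fin n → ℕ) (k : ℕ) (j : Fin n) : ℕ :=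
  r j + ∑ k' ∈ univ.filter fun k' : Fin n => (k' : ℕ) < k,
    if σ k' < j then 1 else if j < σ k' then 2 else 0

theorem scalingExponent_succ (r : Fin n → ℕ) (k : Fin n) (j : Fin n) :
    scalingExponent σ r (k + 1) j =
      scalingExponent σ r k j + if σ k < j then 1 else if j < σ k then 2 else 0 := by
  have h : (univ.filter fun k' : Fin n => (k' : ℕ) < k + 1) =
      insert k (univ.filter fun k' : Fin n => (k' : ℕ) < k) := by
    ext k'
    simp only [mem_filter, mem_univ, true_and, mem_insert, Fin.ext_iff]
    omega
  rw [scalingExponent, h, sum_insert (by simp), scalingExponent]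
  ring

/-- Each earlier integration contributes 1, and one more if it forms an inversion with `k`. This is
the source of the exponents in `γ` and of `binom(n,2) + ℓ(σ)`. -/
theorem scalingExponent_self (r : Fin n → ℕ) (k : Fin n) :
    scalingExponent σ r k (σ k) = r (σ k) + k + invAt σ k := by
  have h : ∀ k' ∈ univ.filter fun k' : Fin n => (k' : ℕ) < k,
      (if σ k' < σ k then 1 else if σ k < σ k' then 2 else 0) =
        1 + if σ k < σ k' then 1 else 0 := fun k' hk' => by
    have hne : k' ≠ k := fun h => by simp [h] at hk'
    rcases lt_or_gt_of_ne (σ.injective.ne hne) with h | h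
    · simp [h, h.not_gt]
    · simp [h, h.not_gt]
  rw [scalingExponent, sum_congr rfl h, sum_add_distrib, ← card_eq_sum_ones, ← card_filter,
    filter_filter, ← add_assoc]
  congr 2
  exact (congrArg card (by ext k'; simp)).trans (Fin.card_Iio k)

theorem hasLOIntegral_gaussState (hq0 : 0 < q) (hq1 : q < 1) {D : Fin n → ℝ⟦X⟧}
    (hD : ∀ j, LatticeSeries (q ^ 2) (D j)) (hpar : ∀ j, HasParity (D j) 0) (r : Fin n → ℕ)
    {γ : Fin n → ℝ} {g : Fin n → ℕ} (hγ : ∀ k, γ (σ k) = q ^ g k)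
    (hg : ∀ k : Fin n, Even (g k + (r (σ k) + k + invAt σ k))) :
    HasLOIntegral σ γ (gaussState q 1 D r)
      (∏ k : Fin n, (q : ℂ) ^ (r (σ k) + k + invAt σ k) * (latticeMoment (q ^ 2) (D (σ k)) : ℂ)) := by
  -- After `k` integrations the variables already integrated out carry the series 1.
  set Dk : ℕ → Fin n → ℝ⟦X⟧ := fun k j => if (σ.symm j : ℕ) < k then 1 else D j with hDk
  set Ck : ℕ → ℂ := fun k => ∏ k' ∈ univ.filter fun k' : Fin n => (k' : ℕ) < k,
    ((q : ℂ) ^ (r (σ k') + k' + invAt σ k') * (latticeMoment (q ^ 2) (D (σ k')) : ℂ)) with hCk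
  have hDk0 : Dk 0 = D := by simp [hDk]
  have hr0 : scalingExponent σ r 0 = r := by
    funext j
    simp [scalingExponent]
  have hDkσ : ∀ k : Fin n, Dk k (σ k) = D (σ k) := fun k => by simp [hDk]
  have hDks : ∀ k : Fin n, Dk (k + 1) = Function.update (Dk k) (σ k) 1 := fun k => by
    funext j
    by_cases hj : j = σ k
    · subst hj
      simp [hDk]
    · have : σ.symm j ≠ k := fun h => hj (by rw [← h, σ.apply_symm_apply])
      have h2 : (σ.symm j : ℕ) ≠ k := fun h => this (Fin.ext h)
      rw [Function.update_of_ne hj]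
      simp only [hDk]
      congr 1
      rw [eq_iff_iff]
      omega
  have hCks : ∀ k : Fin n, Ck (k + 1) =
      Ck k * ((q : ℂ) ^ (r (σ k) + k + invAt σ k) * (latticeMoment (q ^ 2) (D (σ k)) : ℂ)) :=
    fun k => by
      have h : (univ.filter fun k' : Fin n => (k' : ℕ) < k + 1) =
          insert k (univ.filter fun k' : Fin n => (k' : ℕ) < k) := by
        ext k'
        simp only [mem_filter, mem_univ, true_and, mem_insert, Fin.ext_iff]
        omega
      simp only [hCk]
      rw [h, prod_insert (by simp), mul_comm]
  have hent : ∀ k j, EntireSeries (Dk k j) := fun k j => by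
    simp only [hDk]
    split_ifs
    · exact entireSeries_one
    · exact (hD j).entire
  have hpark : ∀ k j, HasParity (Dk k j) 0 := fun k j => by
    simp only [hDk]
    split_ifs
    · exact hasParity_one
    · exact hpar j
  refine ⟨fun k => gaussState q (Ck k) (Dk k) (scalingExponent σ r k), ?_, fun k => ?_, ?_⟩
  · simp [hDk0, hr0, hCk]
  · have := isPartialIntegral_gaussState (C := Ck k) (ρ := scalingExponent σ r k)
      (ρ' := scalingExponent σ r (k + 1)) (l := σ k) hq0 hq1 (hent k) (hpark k)
      (by rw [hDkσ]; exact hD _) (hγ k) (by rw [scalingExponent_self]; exact hg k)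
      (fun i hi => by rw [scalingExponent_succ, if_pos hi])
      (fun i hi => by rw [scalingExponent_succ, if_neg hi.not_gt, if_pos hi])
    rw [scalingExponent_self, hDkσ, ← hDks, ← hCks] at this
    exact this
  · refine TwistedSeries.ext fun E => ?_
    simp only [Fin.val_last]
    rw [TwistedSeries.smul_apply, TwistedSeries.one_apply, gaussState]
    have hDn : Dk n = fun _ => 1 := by
      funext j
      simp [hDk]
    have hCn : Ck n = ∏ k : Fin n, (q : ℂ) ^ (r (σ k) + k + invAt σ k) *
        (latticeMoment (q ^ 2) (D (σ k)) : ℂ) := by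
      simp [hCk]
    rw [hDn, hCn]
    congr 1
    by_cases hE : E = 0
    · subst hE
      simp [weight]
    · obtain ⟨j, hj⟩ := Finsupp.ne_iff.1 hE
      have hj : E j ≠ 0 := hj
      rw [if_neg hE, prod_eq_zero (mem_univ j), mul_zero]
      simp [coeff_one, hj]

end Chain

/-! ### Ordered products of Gaussian type series -/

theorem weight_cov_eq_prod (F E : Fin n →₀ ℕ) :
    weight q (fun i j : Fin n => if j < i then 1 else 0) F E =
      ∏ j, (q : ℂ) ^ (tailSum F j * E j) := by
  rw [weight, prod_pow_eq_pow_sum, sum_comm]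
  congr 1
  refine sum_congr rfl fun j _ => ?_
  rw [tailSum, sum_mul, sum_filter]
  refine sum_congr rfl fun i _ => ?_
  split_ifs <;> simp

/-- By bilinearity, `w(E-F,E-F) w(E-F,F) w(F,E) = w(E,E)`. The missing `w(F,E)` is a product of
powers of `q` linear in `E`, hence a scaling with exponents `tailSum F`. -/
theorem decProd_mul_mono (hq0 : 0 < q) (φ : Fin n → ℝ⟦X⟧) (F : Fin n →₀ ℕ) :
    (decProd (fun j => ofSeries j (φ j)) * mono F : CovExt q n) =
      gaussState q 1 (fun j => φ j * PowerSeries.X ^ F j) (tailSum F) := by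
  have hq : (q : ℂ) ≠ 0 := by exact_mod_cast hq0.ne'
  refine TwistedSeries.ext fun E => ?_
  rw [mul_mono_apply, gaussState, one_mul]
  simp only [coeff_mul_X_pow']
  split_ifs with h
  · have hF : ∀ j, F j ≤ E j := fun j => h j
    have hw : weight q (fun i j : Fin n => if j < i then 1 else 0) (E - F) (E - F) *
        weight q (fun i j : Fin n => if j < i then 1 else 0) (E - F) F *
        weight q (fun i j : Fin n => if j < i then 1 else 0) F E =
        weight q (fun i j : Fin n => if j < i then 1 else 0) E E := by
      rw [← weight_add_right, tsub_add_cancel_of_le h, ← weight_add_left, tsub_add_cancel_of_le h]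
    have hc : weight q (fun i j : Fin n => if j < i then 1 else 0) F E *
        ∏ j, (q : ℂ)⁻¹ ^ (tailSum F j * E j) = 1 := by
      rw [weight_cov_eq_prod, ← prod_mul_distrib]
      refine prod_eq_one fun j _ => ?_
      rw [← mul_pow, mul_inv_cancel₀ hq, one_pow]
    rw [decProd_ofSeries_apply, orderExponent_cov, prod_mul_distrib, ← hw]
    simp only [hF, if_true, Finsupp.coe_tsub, Pi.sub_apply]
    linear_combination (-(weight q (fun i j : Fin n => if j < i then 1 else 0) (E - F) (E - F) *
      weight q (fun i j : Fin n => if j < i then 1 else 0) (E - F) F *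
      ∏ j, ((coeff (E j - F j) (φ j) : ℝ) : ℂ))) * hc
  · obtain ⟨j, hj⟩ : ∃ j, ¬ F j ≤ E j := by
      by_contra! hall
      exact h hall
    rw [prod_eq_zero (mem_univ j), mul_zero]
    simp [hj]

theorem sum_tailSum (F : Fin n → ℕ) : ∑ j, tailSum F j = ∑ j : Fin n, (j : ℕ) * F j := by
  simp only [tailSum, sum_filter]
  rw [sum_comm]
  refine sum_congr rfl fun j _ => ?_
  rw [← sum_filter, sum_const, smul_eq_mul]
  congr 1
  exact (congrArg card (by ext i; simp)).trans (Fin.card_Iio j)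

/-- The exponents `tailSum F` sum to `∑ j F_j`, with `j` counted from zero; these are the powers
that the kernel of the transform cancels. -/
theorem prod_gaussState_integral (σ : Equiv.Perm (Fin n)) (F : Fin n → ℕ) (M : Fin n → ℂ) :
    ∏ k : Fin n, (q : ℂ) ^ (tailSum F (σ k) + k + invAt σ k) * M (σ k) =
      (q : ℂ) ^ (n.choose 2 + permLength σ) * ∏ j : Fin n, ((q : ℂ) ^ ((j : ℕ) * F j) * M j) := by
  rw [prod_mul_distrib, prod_mul_distrib, prod_pow_eq_pow_sum, prod_pow_eq_pow_sum,
    Equiv.prod_comp σ M, sum_add_distrib, sum_add_distrib, Equiv.sum_comp σ (tailSum F),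
    sum_tailSum, Fin.sum_univ_eq_sum_range (fun k => k) n, sum_range_id, ← Nat.choose_two_right,
    permLength, ← mul_assoc, ← pow_add]
  congr 2
  ring

/-- The lattices generated by `γ` for which ordered products of Gaussian type series, with
parities `a`, are integrable. -/
def LatticeFits (q : ℝ) (σ : Equiv.Perm (Fin n)) (a : Fin n → ℕ) (γ : Fin n → ℝ) : Prop :=
  ∃ g : Fin n → ℕ, (∀ k, γ (σ k) = q ^ g k) ∧
    ∀ k : Fin n, Even (g k + (tailSum a (σ k) + k + invAt σ k))

/-- The exponent of `γ` equals the scaling exponent for `F = a`, so their sum is even. -/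
theorem latticeFits_latticeBase (σ : Equiv.Perm (Fin n)) (a : Fin n → ℕ) :
    LatticeFits q σ a (latticeBase q σ a) :=
  ⟨fun k => k + tailSum a (σ k) + invAt σ k, fun k => by simp [latticeBase], fun k => by
    rw [Nat.even_iff]
    dsimp only
    omega⟩

/-- In `γ̃` the number `A^i` enters twice and drops out modulo two, so this lattice suits parities
zero. -/
theorem latticeFits_latticeShift (σ : Equiv.Perm (Fin n)) (a : Fin n → ℕ) :
    LatticeFits q σ (fun _ => 0) (latticeShift q σ a) :=
  ⟨fun k => tailSum a (σ k) + (k + tailSum a (σ k) + invAt σ k),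
    fun k => by simp [latticeShift, latticeBase, pow_add], fun k => by
    rw [Nat.even_iff, tailSum, sum_const_zero]
    dsimp only
    omega⟩

theorem even_tailSum_add {a F : Fin n → ℕ} (h : ∀ j, Even (a j + F j)) (i : Fin n) :
    Even (tailSum a i + tailSum F i) := by
  rw [tailSum, tailSum, ← sum_add_distrib]
  exact even_sum _ fun j _ => h j

theorem hasLOIntegral_decProd_of_odd (hq0 : 0 < q) (σ : Equiv.Perm (Fin n)) {a : Fin n → ℕ}
    (γ : Fin n → ℝ) {φ : Fin n → ℝ⟦X⟧} (hpar : ∀ j, HasParity (φ j) (a j)) {F : Fin n →₀ ℕ} {j : Fin n} (hF : ¬ Even (a j + F j)) :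
    HasLOIntegral σ γ (decProd (fun j => ofSeries j (φ j)) * mono F : CovExt q n) 0 := by
  rw [decProd_mul_mono hq0]
  refine hasLOIntegral_zero (evenPart_gaussState_eq_zero (j := j) ?_) j σ γ
  have h := (hpar j).mul (HasParity.X_pow (F j))
  refine fun e he => h e fun h' => he ?_
  rw [Nat.even_iff] at *
  omega

/-! ### Reduction of the transform to one variable -/

section Transform

variable (hq0 : 0 < q) (hq1 : q < 1) {σ : Equiv.Perm (Fin n)} {a : Fin n → ℕ} {γ : Fin n → ℝ}
  (hγ : LatticeFits q σ a γ) {φ : Fin n → ℝ⟦X⟧} (hφ : ∀ j, LatticeSeries (q ^ 2) (φ j))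
  (hpar : ∀ j, HasParity (φ j) (a j))

include hq0 hq1 hγ hφ hpar

/-- Only the parity of the scaling exponents matters, and `F ≡ a` modulo two forces the same for the
tail sums; thus a single `γ` serves all such `F`. -/
theorem hasLOIntegral_decProd_of_even {F : Fin n →₀ ℕ} (hF : ∀ j, Even (a j + F j)) :
    HasLOIntegral σ γ (decProd (fun j => ofSeries j (φ j)) * mono F : CovExt q n)
      ((q : ℂ) ^ (n.choose 2 + permLength σ) * ∏ j : Fin n, ((q : ℂ) ^ ((j : ℕ) * F j) *
        (latticeMoment (q ^ 2) (φ j * PowerSeries.X ^ F j) : ℂ))) := by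
  obtain ⟨g, hg1, hg2⟩ := hγ
  rw [decProd_mul_mono hq0, ← prod_gaussState_integral]
  refine hasLOIntegral_gaussState σ hq0 hq1 (fun j => (hφ j).mul_X_pow _) (fun j => ?_)
    (tailSum F) hg1 fun k => ?_
  · have h := (hpar j).mul (HasParity.X_pow (F j))
    have := hF j
    refine fun e he => h e fun h' => he ?_
    rw [Nat.even_iff] at *
    omega
  · have h1 := hg2 k
    have h2 := even_tailSum_add hF (σ k)
    rw [Nat.even_iff] at *
    omega

theorem isClassR_decProd :
    IsClassR σ γ (decProd (fun j => ofSeries j (φ j)) : CovExt q n) := by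
  refine fun F => ⟨?_, ?_⟩
  · rw [decProd_mul_mono hq0]
    exact isClassC_gaussState hq0 hq1 fun j => ((hφ j).mul_X_pow _).entire
  · by_cases hF : ∀ j, Even (a j + F j)
    · exact ⟨_, hasLOIntegral_decProd_of_even hq0 hq1 hγ hφ hpar hF⟩
    · push Not at hF
      obtain ⟨j, hj⟩ := hF
      exact ⟨0, hasLOIntegral_decProd_of_odd hq0 σ γ hpar (by simpa using hj)⟩

/-- The transform of an ordered product is computed one variable at a time. -/
theorem weakFourier_decProd {c : Fin n → ℂ} {χ : Fin n → ℝ⟦X⟧} (hχ : ∀ j, HasParity (χ j) (a j))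
    (h : ∀ j F, Even (a j + F) →
      (latticeMoment (q ^ 2) (φ j * PowerSeries.X ^ F) : ℂ) * Complex.I ^ F /
        (qPoch (q ^ 2) (q ^ 2) F : ℂ) = c j * ((coeff F (χ j) : ℝ) : ℂ)) :
    weakFourier σ γ (decProd (fun j => ofSeries j (φ j)) : CovExt q n) =
      ((q : ℂ) ^ (n.choose 2 + permLength σ) * ∏ j, c j) •
        decProd fun j => ofSeries j (χ j) := by
  have hq : (q : ℂ) ≠ 0 := by exact_mod_cast hq0.ne'
  have hQ1 : q ^ 2 < 1 := pow_lt_one₀ hq0.le hq1 two_ne_zero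
  have hQ1' : (1 - (q : ℂ) ^ 2) ≠ 0 := by exact_mod_cast (sub_pos.2 hQ1).ne'
  -- These powers of `1 - q²` cancel the ones in the kernel, leaving `(q²;q²)_F` as the denominator
  -- in `h`.
  have hfac : ∀ m, (qFactorial (q ^ 2) m : ℂ) =
      (qPoch (q ^ 2) (q ^ 2) m : ℂ) / (1 - (q : ℂ) ^ 2) ^ m := fun m => by
    have h1 : qFactorial (q ^ 2) m = qPoch (q ^ 2) (q ^ 2) m / (1 - q ^ 2) ^ m := by
      have h3 : (1 - q ^ 2) ^ m = ∏ _j ∈ range m, (1 - q ^ 2) := by simp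
      rw [qFactorial, qPoch, h3, ← prod_div_distrib]
      refine prod_congr rfl fun j _ => ?_
      rw [qNumber, ← neg_div_neg_eq, neg_sub, neg_sub, pow_succ']
    rw [h1]
    push_cast
    rfl
  refine TwistedSeries.ext fun F => ?_
  rw [weakFourier, TwistedSeries.smul_apply, decProd_ofSeries_apply, orderExponent_vec, pow_zero,
    one_mul]
  by_cases hF : ∀ j, Even (a j + F j)
  · rw [(hasLOIntegral_decProd_of_even hq0 hq1 hγ hφ hpar hF).loIntegral_eq, mul_assoc, mul_assoc,
      ← prod_mul_distrib, ← prod_mul_distrib]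
    congr 1
    refine prod_congr rfl fun j _ => ?_
    rw [← h j _ (hF j), hfac, mul_pow, div_pow, ← pow_mul, inv_pow]
    have : (q : ℂ) ^ ((j : ℕ) * F j) ≠ 0 := pow_ne_zero _ hq
    have h2 : (1 - (q : ℂ) ^ 2) ^ F j ≠ 0 := pow_ne_zero _ hQ1'
    field_simp
  · push Not at hF
    obtain ⟨j, hj⟩ := hF
    have hj' : ¬ Even (a j + F j) := by simpa using hj
    have hz : ∏ j, ((coeff (F j) (χ j) : ℝ) : ℂ) = 0 := prod_eq_zero (mem_univ j) (by
      rw [hχ j _ (by rwa [add_comm]), Complex.ofReal_zero])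
    rw [(hasLOIntegral_decProd_of_odd hq0 σ γ hpar hj').loIntegral_eq, zero_mul, hz, mul_zero]

end Transform

/-! ### The transforms in one variable -/

theorem bConst_eq (q : ℝ) : bConst q = gaussMoment (q ^ 2) := rfl

theorem pow_sq_sub (q : ℝ) (a : ℕ) : q ^ (a ^ 2 - a) = (q ^ 2) ^ a.choose 2 := by
  rw [← pow_mul, Nat.choose_two_right, Nat.mul_div_cancel' (Nat.even_mul_pred_self a).two_dvd,
    sq, Nat.mul_sub_one]

theorem transform_monomial {Q : ℝ} (h0 : 0 < Q) (h1 : Q < 1) {a F : ℕ} (h : Even (a + F)) :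
    (latticeMoment Q (bigGaussSeries Q * PowerSeries.X ^ a * PowerSeries.X ^ F) : ℂ) *
        Complex.I ^ F / (qPoch Q Q F : ℂ) =
      ((Q ^ a.choose 2 : ℝ) : ℂ) * Complex.I ^ a * (gaussMoment Q : ℂ) *
        ((coeff F (hermiteSeriesII Q a * smallGaussSeries Q) : ℝ) : ℂ) := by
  obtain ⟨N, hN⟩ := h
  have hN' : a + F = 2 * N := by omega
  have hI : Complex.I ^ F = Complex.I ^ a * (-1) ^ (N + a) := by
    -- Since `F = 2N - a`, the exponents `a + 2(N + a)` and `F` differ by `4a`.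
    rw [← Complex.I_sq, ← pow_mul, ← pow_add, show a + 2 * (N + a) = F + 4 * a by omega, pow_add,
      pow_mul _ 4, Complex.I_pow_four, one_pow, mul_one]
  have hc := congrArg (fun x : ℝ => (x : ℂ)) (coeff_hermiteSeriesII_mul_smallGauss h0 h1 a F N hN')
  push_cast at hc
  rw [latticeMoment_monomial h0 h1 hN', hI]
  push_cast
  linear_combination (-Complex.I ^ a * (gaussMoment Q : ℂ)) * hc

/-- For `F < a` orthogonality corresponds to the factor `X^a` on the right; otherwise, with `F = a +
2r`, `I^F = I^a (-1)^r` gives the signs of `e_{Q²}(-y²)`. -/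
theorem transform_hermite {Q : ℝ} (h0 : 0 < Q) (h1 : Q < 1) {a F : ℕ} (h : Even (a + F)) :
    (latticeMoment Q (bigGaussSeries Q * hermiteSeriesI Q a * PowerSeries.X ^ F) : ℂ) *
        Complex.I ^ F / (qPoch Q Q F : ℂ) =
      ((Q ^ a.choose 2 : ℝ) : ℂ) * Complex.I ^ a * (gaussMoment Q : ℂ) *
        ((coeff F (PowerSeries.X ^ a * smallGaussSeries Q) : ℝ) : ℂ) := by
  have hpos : (qPoch Q Q F : ℂ) ≠ 0 := by exact_mod_cast (qPoch_pos h1 h0 h1 F).ne'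
  rw [latticeMoment_hermiteSeriesI h0 h1 a F h, coeff_X_pow_mul']
  split_ifs with haF
  · obtain ⟨r, rfl⟩ : ∃ r, F = a + 2 * r := ⟨(F - a) / 2, by rw [Nat.even_iff] at h; omega⟩
    rw [Nat.add_sub_cancel_left, Nat.mul_div_cancel_left r two_pos, pow_add, pow_mul,
      Complex.I_sq]
    simp only [smallGaussSeries, coeff_mk, even_two.mul_right, if_true,
      Nat.mul_div_cancel_left r two_pos]
    push_cast
    field_simp
  · simp

theorem hasLOIntegral_totalGauss (hq0 : 0 < q) (hq1 : q < 1) (σ : Equiv.Perm (Fin n))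
    (a : Fin n → ℕ) :
    HasLOIntegral σ (latticeShift q σ a) (totalGauss q n)
      ((bConst q : ℂ) ^ n * (q : ℂ) ^ (n.choose 2 + permLength σ)) := by
  have hQ1 : q ^ 2 < 1 := pow_lt_one₀ hq0.le hq1 two_ne_zero
  have h := hasLOIntegral_decProd_of_even (F := 0) hq0 hq1 (latticeFits_latticeShift σ a)
    (fun _ => LatticeSeries.bigGauss (by positivity) hQ1)
    (fun _ => HasParity.bigGauss (q ^ 2)) (by simp)
  have hM : latticeMoment (q ^ 2) (bigGaussSeries (q ^ 2) * PowerSeries.X ^ 0) = bConst q := by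
    have := latticeMoment_bigGauss_even (Q := q ^ 2) (by positivity) hQ1 0
    rw [mul_zero, qPoch_zero, mul_one] at this
    exact this
  have h1 : (mono 0 : CovExt q n) = 1 := rfl
  simp only [Finsupp.coe_zero, Pi.zero_apply, mul_zero, pow_zero (q : ℂ), one_mul, hM, prod_const,
    card_univ, Fintype.card_fin, h1, mul_one] at h
  rw [totalGauss_eq_decProd hq0 hq1, mul_comm]
  exact h

theorem isClassC_totalGauss (hq0 : 0 < q) (hq1 : q < 1) : IsClassC (totalGauss q n) := by
  have hQ1 : q ^ 2 < 1 := pow_lt_one₀ hq0.le hq1 two_ne_zero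
  have h1 : (mono 0 : CovExt q n) = 1 := rfl
  rw [totalGauss_eq_decProd hq0 hq1, ← mul_one (decProd _), ← h1, decProd_mul_mono hq0]
  exact isClassC_gaussState hq0 hq1 fun j =>
    ((LatticeSeries.bigGauss (by positivity) hQ1).mul_X_pow _).entire

theorem gauss_mul_pow (q : ℝ) (j : Fin n) (l : ℕ) :
    bigGauss (xv q j) * xv q j ^ l =
      ofSeries j (bigGaussSeries (q ^ 2) * PowerSeries.X ^ l) := by
  rw [bigGauss_xv, ofSeries_mul (by simp), X_pow_eq_ofSeries (by simp)]

theorem gauss_mul_hermiteI (q : ℝ) (j : Fin n) (l : ℕ) :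
    bigGauss (xv q j) * hermiteI (q ^ 2) l (xv q j) =
      ofSeries j (bigGaussSeries (q ^ 2) * hermiteSeriesI (q ^ 2) l) := by
  rw [bigGauss_xv, ofSeries_mul (by simp), hermiteI_X (by simp)]

theorem hermiteII_mul_gauss (q : ℝ) (j : Fin n) (l : ℕ) :
    hermiteII (q ^ 2) l (dv q j) * smallGauss (dv q j) =
      ofSeries j (hermiteSeriesII (q ^ 2) l * smallGaussSeries (q ^ 2)) := by
  rw [smallGauss_dv, ofSeries_mul (by simp), hermiteII_X (by simp)]

theorem pow_mul_gauss (q : ℝ) (j : Fin n) (l : ℕ) :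
    dv q j ^ l * smallGauss (dv q j) =
      ofSeries j (PowerSeries.X ^ l * smallGaussSeries (q ^ 2)) := by
  rw [smallGauss_dv, ofSeries_mul (by simp), X_pow_eq_ofSeries (by simp)]

theorem prod_transform_factor (q : ℝ) (a : Fin n → ℕ) :
    ∏ j, ((((q ^ 2) ^ (a j).choose 2 : ℝ) : ℂ) * Complex.I ^ a j * (gaussMoment (q ^ 2) : ℂ)) =
      (q : ℂ) ^ (∑ j, (a j ^ 2 - a j)) * Complex.I ^ (∑ j, a j) * (bConst q : ℂ) ^ n := by
  simp only [← pow_sq_sub, prod_mul_distrib, Complex.ofReal_pow, prod_pow_eq_pow_sum, prod_const,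
    card_univ, Fintype.card_fin, bConst_eq]

end QuantumSpace

end

open QuantumSpace

/-! ### Assembly of the three statements -/

theorem mainTheorem5 (q : ℝ) (hq0 : 0 < q) (hq1 : q < 1) (n : ℕ) (σ : Equiv.Perm (Fin n))
    (a : Fin n → ℕ) :
    -- the integral of the total Gaussian
    (QuantumSpace.LOIntegrable σ (QuantumSpace.latticeShift q σ a)
        (QuantumSpace.totalGauss q n) ∧
      QuantumSpace.loIntegral σ (QuantumSpace.latticeShift q σ a) (QuantumSpace.totalGauss q n) =
        (QuantumSpace.bConst q : ℂ) ^ n *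
          (q : ℂ) ^ (n.choose 2 + QuantumSpace.permLength σ)) ∧
    -- the transform of Gaussians times monomials
    (QuantumSpace.IsClassR σ (QuantumSpace.latticeBase q σ a)
        (QuantumSpace.TwistedSeries.decProd fun j =>
          QuantumSpace.bigGauss (QuantumSpace.xv q j) * QuantumSpace.xv q j ^ a j) ∧
      QuantumSpace.weakFourier σ (QuantumSpace.latticeBase q σ a)
        (QuantumSpace.TwistedSeries.decProd fun j =>
          QuantumSpace.bigGauss (QuantumSpace.xv q j) * QuantumSpace.xv q j ^ a j) =
        ((q : ℂ) ^ (∑ j, (a j ^ 2 - a j)) * Complex.I ^ (∑ j, a j) *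
            (QuantumSpace.bConst q : ℂ) ^ n *
            (q : ℂ) ^ (n.choose 2 + QuantumSpace.permLength σ)) •
          QuantumSpace.TwistedSeries.decProd fun j =>
            QuantumSpace.TwistedSeries.hermiteII (q ^ 2) (a j) (QuantumSpace.dv q j) *
              QuantumSpace.smallGauss (QuantumSpace.dv q j)) ∧
    -- the transform of Gaussians times discrete Hermite I polynomials
    (QuantumSpace.IsClassR σ (QuantumSpace.latticeBase q σ a)
        (QuantumSpace.TwistedSeries.decProd fun j =>
          QuantumSpace.bigGauss (QuantumSpace.xv q j) *
            QuantumSpace.TwistedSeries.hermiteI (q ^ 2) (a j) (QuantumSpace.xv q j)) ∧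
      QuantumSpace.weakFourier σ (QuantumSpace.latticeBase q σ a)
        (QuantumSpace.TwistedSeries.decProd fun j =>
          QuantumSpace.bigGauss (QuantumSpace.xv q j) *
            QuantumSpace.TwistedSeries.hermiteI (q ^ 2) (a j) (QuantumSpace.xv q j)) =
        (Complex.I ^ (∑ j, a j) * (q : ℂ) ^ (∑ j, (a j ^ 2 - a j)) *
            QuantumSpace.loIntegral σ (QuantumSpace.latticeShift q σ a)
              (QuantumSpace.totalGauss q n)) •
          QuantumSpace.TwistedSeries.decProd fun j =>
            QuantumSpace.dv q j ^ a j * QuantumSpace.smallGauss (QuantumSpace.dv q j)) := by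
  have hQ0 : 0 < q ^ 2 := by positivity
  have hQ1 : q ^ 2 < 1 := pow_lt_one₀ hq0.le hq1 two_ne_zero
  have hfit := latticeFits_latticeBase (q := q) σ a
  have hG := LatticeSeries.bigGauss hQ0 hQ1
  have hφ : ∀ j, LatticeSeries (q ^ 2) (bigGaussSeries (q ^ 2) * PowerSeries.X ^ a j) :=
    fun j => hG.mul_X_pow _
  have hpar : ∀ j, HasParity (bigGaussSeries (q ^ 2) * PowerSeries.X ^ a j) (a j) := fun j => by
    simpa using (HasParity.bigGauss (q ^ 2)).mul (HasParity.X_pow (a j))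
  have hφ' : ∀ j, LatticeSeries (q ^ 2) (bigGaussSeries (q ^ 2) * hermiteSeriesI (q ^ 2) (a j)) :=
    fun j => hG.mul_hermiteSeries _ _ _
  have hpar' : ∀ j, HasParity (bigGaussSeries (q ^ 2) * hermiteSeriesI (q ^ 2) (a j)) (a j) :=
    fun j => by simpa using (HasParity.bigGauss (q ^ 2)).mul (HasParity.hermite (q ^ 2) _ (a j))
  have hI := hasLOIntegral_totalGauss hq0 hq1 σ a
  -- Every factor of the ordered products is a series in a single variable, so the one-variable
  -- transforms apply.
  simp only [gauss_mul_pow, gauss_mul_hermiteI, hermiteII_mul_gauss, pow_mul_gauss]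
  refine ⟨⟨⟨isClassC_totalGauss hq0 hq1, _, hI⟩, hI.loIntegral_eq⟩,
    ⟨isClassR_decProd hq0 hq1 hfit hφ hpar, ?_⟩, isClassR_decProd hq0 hq1 hfit hφ' hpar', ?_⟩
  · rw [weakFourier_decProd hq0 hq1 hfit hφ hpar
      (fun j => by simpa using (HasParity.hermite _ _ (a j)).mul (HasParity.smallGauss (q ^ 2)))
      fun j F h => transform_monomial hQ0 hQ1 h, prod_transform_factor]
    congr 1
    ring
  · rw [weakFourier_decProd hq0 hq1 hfit hφ' hpar'
      (fun j => by simpa using (HasParity.X_pow (a j)).mul (HasParity.smallGauss (q ^ 2)))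
      fun j F h => transform_hermite hQ0 hQ1 h, prod_transform_factor, hI.loIntegral_eq]
    congr 1
    ring
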